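/- For $\theta\in\mathbb R$ let $$f_\theta=\Big(\cos\theta\,\frac{2}{1+|x|^2},\ \sin\theta\,\Big(\frac{2}{1+|x|^2}\Big)^2\Big),\qquad x\in\mathbb R^3,$$ and let $v_\theta=Sf_\theta$ be the solution on $\mathbb R^{1+3}$ of the linear wave equation $\partial_t^2v=\Delta v$ with $(v,\partial_tv)|_{t=0}=f_\theta$, that is, $$v_\theta(t,\cdot)=\cos(t\sqrt{-\Delta})\,f_{\theta,0}+\frac{\sin(t\sqrt{-\Delta})}{\sqrt{-\Delta}}\,f_{\theta,1}.$$ For $F\in L^{4/3}(\mathbb R^{1+3})$ let $$\Box^{-1}F(t,\cdot)=\int_{-\infty}^t\frac{\sin((t-s)\sqrt{-\Delta})}{\sqrt{-\Delta}}\,F(s,\cdot)\,ds$$ be the retarded solution of $(\partial_t^2-\Delta)w=F$, and for $w\in L^4(\mathbb R^{1+3})$ let $\mathcal S(w)=\iint_{\mathbb R^{1+3}}w^3\,\Box^{-1}(w^3)\,dt\,dx$. Then for every $\theta\in\mathbb R$ the Penrose transform of $v_\theta$ is $\cos(T-\theta)$, i.e. for every $t$ and almost every $x$ $$v_\theta(t,x)=\Omega(t,x)\cos(T-\theta),\qquad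 T=\arctan(t+|x|)+\arctan(t-|x|),\qquad \Omega=\frac{2}{\sqrt{1+(t+|x|)^2}\,\sqrt{1+(t-|x|)^2}};$$ moreover $v_\theta$ and $\Box^{-1}(v_\theta^3)$ belong to $L^4(\mathbb R^{1+3})$, the integral defining $\mathcal S(v_\theta)$ converges absolutely, and $$\mathcal S(v_\theta)=\frac{\pi^3}{128}\big(24\cos^2\theta+5\big).$$ -/

import Mathlib

open MeasureTheory
open scoped FourierTransform SchwartzMap

noncomputable section

namespace CubicWave

/-- The Euclidean space `ℝ³`. -/
abbrev Space : Type := EuclideanSpace ℝ (Fin 3)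

/-- The spacetime `ℝ^{1+3}`, whose points are written `(t, x)`; its measure is `dt dx`. -/
abbrev Spacetime : Type := ℝ × Space

/-- `cos (t √-Δ) φ` for a Schwartz function `φ`. With the Fourier transform
`𝓕 φ ξ = ∫ exp (-2πi x·ξ) φ x dx`, the operator `√-Δ` is multiplication by `2π|ξ|`. -/
def cosPropagator (t : ℝ) (φ : 𝓢(Space, ℂ)) : Space → ℂ :=
  𝓕⁻ (fun ξ : Space =>
    ((Real.cos (t * (2 * Real.pi * ‖ξ‖)) : ℝ) : ℂ) * 𝓕 (φ : Space → ℂ) ξ)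

/-- `(sin (t √-Δ) / √-Δ) φ` for a Schwartz function `φ`. Since `sinc y = sin y / y`, `sinc 0 = 1`,
the multiplier is `sin (t ρ) / ρ` with `ρ = 2π|ξ|`, extended by its limit `t` at `ρ = 0`. -/
def sinPropagator (t : ℝ) (φ : 𝓢(Space, ℂ)) : Space → ℂ :=
  𝓕⁻ (fun ξ : Space =>
    ((t * Real.sinc (t * (2 * Real.pi * ‖ξ‖)) : ℝ) : ℂ) * 𝓕 (φ : Space → ℂ) ξ)

/-- `v = S (f₀, f₁)`: the solution of `∂ₜ² v = Δ v` with data `(v, ∂ₜ v) = (f₀, f₁)` at `t = 0`, i.e.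
`v t = cos (t √-Δ) f₀ + (sin (t √-Δ) / √-Δ) f₁` as tempered distributions on `ℝ³`, for every `t`.
The two Fourier multipliers are real and even, so they act on tempered distributions by
duality with their action on Schwartz functions. These conditions determine `v t` almost everywhere
on `ℝ³`, for every `t`. -/
structure IsLinearWave (f₀ f₁ : Space → ℝ) (v : Spacetime → ℝ) : Prop where
  aestronglyMeasurable : AEStronglyMeasurable v volume
  integrable_slice : ∀ (t : ℝ) (φ : 𝓢(Space, ℂ)),
    Integrable (fun x : Space => (v (t, x) : ℂ) * φ x)
  duality : ∀ (t : ℝ) (φ : 𝓢(Space, ℂ)),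
    ∫ x : Space, (v (t, x) : ℂ) * φ x =
      (∫ x : Space, (f₀ x : ℂ) * cosPropagator t φ x) +
        ∫ x : Space, (f₁ x : ℂ) * sinPropagator t φ x

/-- `w = □⁻¹ F`, for `F ∈ L^{4/3}(ℝ^{1+3})`: the retarded Duhamel integral
`w t = ∫_{-∞}^t (sin ((t - s) √-Δ) / √-Δ) (F s) ds`, an identity of tempered distributions on `ℝ³` for
every `t`. By the Strichartz estimate `(s, x) ↦ sinPropagator (t - s) φ x` is in `L⁴(ℝ^{1+3})`, so
that the integral on the right converges absolutely. These conditions determine `w t` almost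
everywhere on `ℝ³`, for every `t`. -/
structure IsRetardedSolution (F w : Spacetime → ℝ) : Prop where
  memLp_source : MemLp F (4 / 3) volume
  aestronglyMeasurable : AEStronglyMeasurable w volume
  integrable_slice : ∀ (t : ℝ) (φ : 𝓢(Space, ℂ)),
    Integrable (fun x : Space => (w (t, x) : ℂ) * φ x)
  duality : ∀ (t : ℝ) (φ : 𝓢(Space, ℂ)),
    ∫ x : Space, (w (t, x) : ℂ) * φ x =
      ∫ s in Set.Iio t, ∫ x : Space, (F (s, x) : ℂ) * sinPropagator (t - s) φ x

/-- The first component `cos θ · 2 / (1 + |x|²)` of the initial data `f_θ`. -/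
def data₀ (θ : ℝ) (x : Space) : ℝ := Real.cos θ * (2 / (1 + ‖x‖ ^ 2))

/-- The second component `sin θ · (2 / (1 + |x|²))²` of the initial data `f_θ`. -/
def data₁ (θ : ℝ) (x : Space) : ℝ := Real.sin θ * (2 / (1 + ‖x‖ ^ 2)) ^ 2

/-- The Penrose map `(t, x) ↦ (T, (cos R, sin R · x / |x|))` from `ℝ^{1+3}` to `ℝ × S³`, where
`T = arctan (t + |x|) + arctan (t - |x|)` and `R = arctan (t + |x|) - arctan (t - |x|)`.
Points of `S³` are written as pairs in `ℝ × ℝ³`; at `x = 0` one has `R = 0`. -/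
def penroseMap (p : Spacetime) : ℝ × (ℝ × Space) :=
  let T : ℝ := Real.arctan (p.1 + ‖p.2‖) + Real.arctan (p.1 - ‖p.2‖)
  let R : ℝ := Real.arctan (p.1 + ‖p.2‖) - Real.arctan (p.1 - ‖p.2‖)
  (T, (Real.cos R, (Real.sin R / ‖p.2‖) • p.2))

/-- The conformal factor `Ω = 2 (1 + (t + |x|)²)^{-1/2} (1 + (t - |x|)²)^{-1/2}`. -/
def conformalFactor (p : Spacetime) : ℝ :=
  2 / (Real.sqrt (1 + (p.1 + ‖p.2‖) ^ 2) * Real.sqrt (1 + (p.1 - ‖p.2‖) ^ 2))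

/-- `V` is the Penrose transform of `v`, i.e. `v = Ω · (V ∘ P)` with `P` the Penrose map; at every
time the identity is one of functions defined almost everywhere on `ℝ³`. Only the values of `V` on
the image of `P` matter. -/
def IsPenroseTransform (v : Spacetime → ℝ) (V : ℝ × (ℝ × Space) → ℝ) : Prop :=
  ∀ t : ℝ, ∀ᵐ x : Space, v (t, x) = conformalFactor (t, x) * V (penroseMap (t, x))

end CubicWave

end

namespace CubicWave

/-! The statement is proved for two explicit radial functions, `wave θ` and `retardedWave θ`.
Pairings with Schwartz functions determine each time slice almost everywhere, so the conclusions
pass to every `v` and `w` satisfying the defining conditions.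

Linear part: put ρ = 2π|ξ|. The data have Fourier transforms cos θ · 2π e^{-ρ}/|ξ| and sin θ · 4π²
e^{-ρ}, so the flow produces the single profile 2π e^{-ρ} cos(tρ - θ)/|ξ|. The Fourier transform of
a radial function on ℝ³ is a sine transform (`fourier_radial`), which here reduces to ∫ e^{-s}
sin(ps - θ) ds with p = t ± |x|. The result is a rational function of t ± |x|, equal to Ω cos(T - θ)
by the addition formulas for arctan (`fourier_spectralProfile`, `integral_waveProfile_mul`).

Retarded part: for a radial source F, the operator sin(τ√-Δ)/√-Δ gives 1/(2r) times the integral of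
ρF(ρ) over [r - τ, r + τ] (`integral_mul_sinPropagator`). Extend everything to r < 0 by parity and
use a = arctan(t + r), b = arctan(t - r), which map the plane onto a square with Jacobian J. Since
rΩ = sin R and Ω² = 2J, the measure r v³ dt dr becomes 2 sin(a - b) cos³(a + b - θ) da db, and the
backward light cone becomes a rectangle with a corner at (-π/2, -π/2). Hence r □⁻¹(v³) is the double
primitive `nullPotential`, an explicit combination of linear and trigonometric terms. It vanishes on
the diagonal and is bounded by a multiple of sin R, so □⁻¹(v³) is bounded by a multiple of Ω, which
lies in L⁴.

Action: evenness in r gives 𝒮 = 2π ∫ (r v³)(r □⁻¹ v³) dt dr = 4π times the integral of source times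
potential over the square. That integral is evaluated twice by the single one-variable formula
`integral_trigPoly_mul`. -/

/-! ### Axial and radial distributions of Lebesgue measure on ℝ³, and radial Fourier transforms. -/

lemma lintegral_Ioi_eq_lintegral_sq (G : ℝ → ENNReal) :
    ∫⁻ q in Set.Ioi (0 : ℝ), G q =
      ∫⁻ r in Set.Ioi (0 : ℝ), ENNReal.ofReal (2 * r) * G (r ^ 2) := by
  have himg : (fun r : ℝ => r ^ 2) '' Set.Ioi 0 = Set.Ioi 0 := by
    ext q
    constructor
    · rintro ⟨r, hr, rfl⟩
      exact pow_pos (Set.mem_Ioi.1 hr) 2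
    · intro hq
      exact ⟨√q, Real.sqrt_pos.2 hq, Real.sq_sqrt (le_of_lt hq)⟩
  have h := lintegral_image_eq_lintegral_abs_deriv_mul (s := Set.Ioi (0 : ℝ))
    (f := fun r : ℝ => r ^ 2) (f' := fun r => 2 * r) measurableSet_Ioi
    (fun x _ => by simpa using (hasDerivAt_pow 2 x).hasDerivWithinAt)
    (fun x hx y hy hxy => (pow_left_inj₀ (le_of_lt hx) (le_of_lt hy) two_ne_zero).1 hxy) G
  rw [himg] at h
  rw [h]
  refine setLIntegral_congr_fun measurableSet_Ioi fun r hr => ?_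
  have : 0 < r := hr
  simp only [abs_of_pos (by positivity : 0 < 2 * r)]

/-- The disc of squared radius q has area πq, so the squared radius in the plane has constant
density π; polar coordinates make this precise. -/
lemma lintegral_comp_sq_add_sq {K : ℝ → ENNReal} (hK : Measurable K) :
    ∫⁻ z : ℝ × ℝ, K (z.1 ^ 2 + z.2 ^ 2) =
      ENNReal.ofReal Real.pi * ∫⁻ q in Set.Ioi (0 : ℝ), K q := by
  rw [← lintegral_comp_polarCoord_symm, lintegral_Ioi_eq_lintegral_sq]
  have : ∀ p : ℝ × ℝ, ENNReal.ofReal p.1 • K ((polarCoord.symm p).1 ^ 2 +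
      (polarCoord.symm p).2 ^ 2) = ENNReal.ofReal p.1 * K (p.1 ^ 2) := by
    intro p
    have : (polarCoord.symm p).1 ^ 2 + (polarCoord.symm p).2 ^ 2 = p.1 ^ 2 := by
      simp only [polarCoord_symm_apply]
      linear_combination p.1 ^ 2 * Real.cos_sq_add_sin_sq p.2
    rw [this, smul_eq_mul]
  simp only [this, polarCoord_target]
  rw [Measure.volume_eq_prod, setLIntegral_prod _ (by fun_prop)]
  rw [← lintegral_const_mul _ (by fun_prop)]
  refine setLIntegral_congr_fun measurableSet_Ioi fun r hr => ?_
  have hr : 0 < r := hr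
  simp only
  rw [setLIntegral_const, Real.volume_Ioo, show Real.pi - -Real.pi = 2 * Real.pi by ring,
    ENNReal.ofReal_mul (by norm_num : (0 : ℝ) ≤ 2), ENNReal.ofReal_mul (by norm_num : (0 : ℝ) ≤ 2)]
  ring

/-- The joint distribution of `(|x|, x · e)` under Lebesgue measure on `ℝ³`, for a unit vector `e`. -/
noncomputable def axialMeasure : Measure (ℝ × ℝ) :=
  (volume.restrict {z : ℝ × ℝ | |z.2| < z.1}).withDensity fun z => ENNReal.ofReal (2 * Real.pi * z.1)

lemma measurableSet_axial : MeasurableSet {z : ℝ × ℝ | |z.2| < z.1} :=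
  measurableSet_lt (by fun_prop) (by fun_prop)

/-- With u the axial coordinate fixed, the transverse plane contributes π dq with q = r² - u². Since
dq = 2r dr, the density is 2πr on |u| < r. -/
lemma lintegral_axial_coord {H : ℝ × ℝ → ENNReal} (hH : Measurable H) :
    ∫⁻ y : Space, H (‖y‖, y 0) = ∫⁻ z, H z ∂axialMeasure := by
  have h1 : ∫⁻ y : Space, H (‖y‖, y 0) =
      ∫⁻ y : Fin 3 → ℝ, H (√(y 0 ^ 2 + (y 1 ^ 2 + y 2 ^ 2)), y 0) := by
    rw [← (EuclideanSpace.volume_preserving_symm_measurableEquiv_toLp (Fin 3)).lintegral_comp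
      (by fun_prop)]
    refine lintegral_congr fun y => ?_
    rw [EuclideanSpace.norm_eq, Fin.sum_univ_three]
    simp [add_assoc]
  have h2 : ∫⁻ y : Fin 3 → ℝ, H (√(y 0 ^ 2 + (y 1 ^ 2 + y 2 ^ 2)), y 0) =
      ∫⁻ z : ℝ × (Fin 2 → ℝ), H (√(z.1 ^ 2 + (z.2 0 ^ 2 + z.2 1 ^ 2)), z.1) := by
    rw [← (volume_preserving_piFinSuccAbove (fun _ : Fin 3 => ℝ) 0).lintegral_comp (by fun_prop)]
    refine lintegral_congr fun y => ?_
    simp [MeasurableEquiv.piFinSuccAbove, Fin.tail]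
  rw [h1, h2, Measure.volume_eq_prod, lintegral_prod _ (by fun_prop)]
  have h3 : ∀ u : ℝ, ∫⁻ z : Fin 2 → ℝ, H (√(u ^ 2 + (z 0 ^ 2 + z 1 ^ 2)), u) =
      ∫⁻ r, Set.indicator {r : ℝ | |u| < r} (fun r => ENNReal.ofReal (2 * Real.pi * r) * H (r, u)) r := by
    intro u
    have h4 := (volume_preserving_finTwoArrow ℝ).lintegral_comp
      (f := fun z : ℝ × ℝ => H (√(u ^ 2 + (z.1 ^ 2 + z.2 ^ 2)), u)) (by fun_prop)
    simp only [MeasurableEquiv.finTwoArrow_apply] at h4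
    rw [h4, lintegral_comp_sq_add_sq (K := fun q => H (√(u ^ 2 + q), u)) (by fun_prop)]
    -- Translation by u² turns the transverse squared radius into the full squared radius.
    have h5 : ∫⁻ q in Set.Ioi (0 : ℝ), H (√(u ^ 2 + q), u) =
        ∫⁻ q in Set.Ioi (0 : ℝ), (Set.Ioi (u ^ 2)).indicator (fun q => H (√q, u)) q := by
      rw [← lintegral_indicator measurableSet_Ioi, ← lintegral_indicator measurableSet_Ioi,
        ← lintegral_add_right_eq_self (Set.indicator _ (Set.indicator _ _)) (u ^ 2)]
      refine lintegral_congr fun q => ?_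
      by_cases hq : 0 < q
      · have : 0 < q + u ^ 2 := by positivity
        simp [Set.indicator, hq, this, add_comm]
      · simp [Set.indicator, hq]
    rw [h5, lintegral_Ioi_eq_lintegral_sq, ← lintegral_const_mul' _ _ ENNReal.ofReal_ne_top,
      ← lintegral_indicator measurableSet_Ioi]
    refine lintegral_congr fun r => ?_
    by_cases hr : 0 < r
    · have : u ^ 2 < r ^ 2 ↔ |u| < r := by rw [sq_lt_sq, abs_of_pos hr]
      by_cases hur : |u| < r
      · have h6 : u ^ 2 < r ^ 2 := this.2 hur
        simp only [Set.indicator, Set.mem_Ioi, hr, h6, if_true, Set.mem_ofPred_eq, hur,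
          Real.sqrt_sq hr.le]
        rw [← mul_assoc, ← ENNReal.ofReal_mul Real.pi_pos.le]
        ring_nf
      · have h6 : ¬ u ^ 2 < r ^ 2 := fun h => hur (this.1 h)
        simp [Set.indicator, h6, hur]
    · have : ¬ |u| < r := fun h => hr ((abs_nonneg u).trans_lt h)
      simp [Set.indicator, hr, this]
  simp only [h3]
  rw [lintegral_lintegral_swap, axialMeasure, lintegral_withDensity_eq_lintegral_mul _ (by fun_prop) hH,
    ← lintegral_indicator measurableSet_axial, Measure.volume_eq_prod, lintegral_prod]
  · rfl
  · refine (Measurable.indicator ?_ measurableSet_axial).aemeasurable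
    exact Measurable.mul (by fun_prop) hH
  · have : Function.uncurry (fun u r : ℝ => Set.indicator {r : ℝ | |u| < r}
        (fun r => ENNReal.ofReal (2 * Real.pi * r) * H (r, u)) r) =
        Set.indicator {z : ℝ × ℝ | |z.1| < z.2}
          (fun z => ENNReal.ofReal (2 * Real.pi * z.2) * H (z.2, z.1)) := by
      ext z
      simp [Function.uncurry, Set.indicator]
    rw [this]
    exact (Measurable.indicator (by fun_prop)
      (measurableSet_lt (by fun_prop) (by fun_prop))).aemeasurable

/-- Completing e to an orthonormal basis with e in position 0 reduces to the first coordinate,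
because the coordinate isometry preserves volume. -/
lemma measurePreserving_axial {e : Space} (he : ‖e‖ = 1) :
    MeasurePreserving (fun x : Space => (‖x‖, inner ℝ e x)) volume axialMeasure := by
  refine ⟨by fun_prop, Measure.ext fun s hs => ?_⟩
  obtain ⟨b, hb⟩ := Orthonormal.exists_orthonormalBasis_extension_of_card_eq (𝕜 := ℝ) (E := Space)
    (ι := Fin 3) (by simp) (v := fun _ => e) (s := {0}) (by
      constructor
      · simpa using he
      · intro i j hij
        exact absurd (Subtype.ext (i.2.trans j.2.symm)) hij)
  have hb0 : b 0 = e := hb 0 rfl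
  have h := b.measurePreserving_repr.lintegral_comp
    (f := fun y : Space => s.indicator 1 (‖y‖, y 0)) (by
      exact (measurable_one.indicator hs).comp (by fun_prop))
  rw [lintegral_axial_coord (measurable_one.indicator hs), lintegral_indicator_one hs] at h
  rw [← h, Measure.map_apply (by fun_prop) hs, ← lintegral_indicator_one
    ((by fun_prop : Measurable fun x : Space => (‖x‖, inner ℝ e x)) hs)]
  refine lintegral_congr fun x => ?_
  rw [b.repr.norm_map, b.repr_apply_apply, hb0]
  rfl

/-- The distribution of `|x|` under Lebesgue measure on `ℝ³`. -/
noncomputable def radialMeasure : Measure ℝ :=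
  (volume.restrict (Set.Ioi (0 : ℝ))).withDensity fun r => ENNReal.ofReal (4 * Real.pi * r ^ 2)

instance : SFinite radialMeasure := by unfold radialMeasure; infer_instance

lemma lintegral_axialMeasure {H : ℝ × ℝ → ENNReal} (hH : Measurable H) :
    ∫⁻ z, H z ∂axialMeasure =
      ∫⁻ r in Set.Ioi (0 : ℝ), ∫⁻ u in Set.Ioo (-r) r, ENNReal.ofReal (2 * Real.pi * r) * H (r, u) := by
  rw [axialMeasure, lintegral_withDensity_eq_lintegral_mul _ (by fun_prop) hH,
    ← lintegral_indicator measurableSet_axial, Measure.volume_eq_prod, lintegral_prod _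
    ((Measurable.mul (by fun_prop) hH).indicator measurableSet_axial).aemeasurable,
    ← lintegral_indicator measurableSet_Ioi]
  refine lintegral_congr fun r => ?_
  by_cases hr : 0 < r
  · rw [Set.indicator_of_mem (Set.mem_Ioi.2 hr), ← lintegral_indicator measurableSet_Ioo]
    refine lintegral_congr fun u => ?_
    by_cases hu : |u| < r
    · simp [Set.indicator, hu, abs_lt.1 hu]
    · have : ¬ (-r < u ∧ u < r) := fun h => hu (abs_lt.2 h)
      simp only [Set.indicator, Set.mem_ofPred_eq, hu, Set.mem_Ioo, this, if_false]
  · rw [Set.indicator_of_notMem (by simpa using hr)]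
    simp only [Set.indicator]
    have : ∀ u : ℝ, ¬ |u| < r := fun u h => hr ((abs_nonneg u).trans_lt h)
    simp [this]

/-- This is the first marginal of `axialMeasure`: integrating 2πr over -r < u < r gives 4πr². -/
lemma measurePreserving_norm :
    MeasurePreserving (fun x : Space => ‖x‖) volume radialMeasure := by
  refine ⟨by fun_prop, Measure.ext fun s hs => ?_⟩
  have he : ‖(EuclideanSpace.single 0 1 : Space)‖ = 1 := by simp
  have h := (measurePreserving_axial he).lintegral_comp
    (f := fun z => s.indicator 1 z.1) ((measurable_one.indicator hs).comp measurable_fst)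
  rw [lintegral_axialMeasure (H := fun z => s.indicator 1 z.1)
    ((measurable_one.indicator hs).comp measurable_fst)] at h
  rw [Measure.map_apply (by fun_prop) hs, ← lintegral_indicator_one
    ((by fun_prop : Measurable fun x : Space => ‖x‖) hs)]
  refine (h.trans ?_)
  rw [radialMeasure, ← lintegral_indicator_one hs, lintegral_withDensity_eq_lintegral_mul _
    (by fun_prop) (measurable_one.indicator hs)]
  refine setLIntegral_congr_fun measurableSet_Ioi fun r hr => ?_
  have hr : 0 < r := hr
  simp only [setLIntegral_const, Real.volume_Ioo, Pi.mul_apply]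
  rw [mul_right_comm, ← ENNReal.ofReal_mul (by positivity)]
  ring_nf

lemma integral_radialMeasure {E : Type*} [NormedAddCommGroup E] [NormedSpace ℝ E] (f : ℝ → E) :
    ∫ r, f r ∂radialMeasure = ∫ r in Set.Ioi (0 : ℝ), (4 * Real.pi * r ^ 2) • f r := by
  rw [radialMeasure, integral_withDensity_eq_integral_toReal_smul (by fun_prop) (by simp)]
  refine setIntegral_congr_fun measurableSet_Ioi fun r hr => ?_
  have : 0 ≤ 4 * Real.pi * r ^ 2 := by positivity
  simp only [ENNReal.toReal_ofReal this]

lemma integrable_radialMeasure {E : Type*} [NormedAddCommGroup E] [NormedSpace ℝ E] {f : ℝ → E} :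
    Integrable f radialMeasure ↔
      IntegrableOn (fun r => (4 * Real.pi * r ^ 2) • f r) (Set.Ioi (0 : ℝ)) := by
  rw [radialMeasure, integrable_withDensity_iff_integrable_smul' (by fun_prop) (by simp)]
  refine integrable_congr (Filter.Eventually.of_forall fun r => ?_)
  have : 0 ≤ 4 * Real.pi * r ^ 2 := by positivity
  simp only [ENNReal.toReal_ofReal this]

/-- The Fourier transform of a radial function on `ℝ³` is a sine transform. -/
lemma fourier_radial {F : ℝ → ℂ} (hFm : Measurable F)
    (hF : Integrable fun x : Space => F ‖x‖) {ξ : Space} (hξ : ξ ≠ 0) :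
    𝓕 (fun x : Space => F ‖x‖) ξ =
      ((2 / ‖ξ‖ : ℝ) : ℂ) * ∫ r in Set.Ioi (0 : ℝ), (r * Real.sin (2 * Real.pi * ‖ξ‖ * r) : ℝ) * F r := by
  have hk : 0 < ‖ξ‖ := norm_pos_iff.2 hξ
  set k := ‖ξ‖ with hkdef
  set e : Space := (k⁻¹ : ℝ) • ξ with he
  have he1 : ‖e‖ = 1 := by
    rw [he, norm_smul, ← hkdef, norm_inv, Real.norm_of_nonneg hk.le, inv_mul_cancel₀ hk.ne']
  have hξe : ξ = k • e := by rw [he, smul_smul, mul_inv_cancel₀ hk.ne', one_smul]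
  have hP := measurePreserving_axial he1
  set G : ℝ × ℝ → ℂ := fun z => Complex.exp (((-2 * Real.pi * (k * z.2) : ℝ) : ℂ) * Complex.I) • F z.1
    with hG
  have hGm : Measurable G := by
    have : Measurable fun z : ℝ × ℝ => F z.1 := hFm.comp measurable_fst
    exact (by fun_prop : Measurable fun z : ℝ × ℝ =>
      Complex.exp (((-2 * Real.pi * (k * z.2) : ℝ) : ℂ) * Complex.I)).smul this
  have h1 : 𝓕 (fun x : Space => F ‖x‖) ξ = ∫ z, G z ∂axialMeasure := by
    rw [Real.fourier_eq', ← hP.map_eq, integral_map hP.aemeasurable hGm.aestronglyMeasurable]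
    refine integral_congr_ae (Filter.Eventually.of_forall fun x => ?_)
    simp only [hG]
    rw [real_inner_comm x e]
    conv_lhs => rw [hξe, real_inner_smul_right]
  have hGi : Integrable G axialMeasure := by
    rw [← hP.map_eq, integrable_map_measure hGm.aestronglyMeasurable hP.aemeasurable]
    refine hF.mono (hGm.comp hP.measurable).aestronglyMeasurable
      (Filter.Eventually.of_forall fun x => ?_)
    simp only [Function.comp, hG, norm_smul, Complex.norm_exp_ofReal_mul_I, one_mul, le_refl]
  have hd : ∀ᵐ z : ℝ × ℝ ∂volume.restrict {z : ℝ × ℝ | |z.2| < z.1},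
      ENNReal.ofReal (2 * Real.pi * z.1) < ⊤ := by simp
  have hdm : Measurable fun z : ℝ × ℝ => ENNReal.ofReal (2 * Real.pi * z.1) := by fun_prop
  have hGi' := (integrable_withDensity_iff_integrable_smul' hdm hd).1 hGi
  have hGi'' := (integrable_indicator_iff measurableSet_axial).2 hGi'
  rw [h1, axialMeasure, integral_withDensity_eq_integral_toReal_smul hdm hd,
    ← integral_indicator measurableSet_axial, Measure.volume_eq_prod, integral_prod _ hGi'',
    ← integral_const_mul, ← integral_indicator measurableSet_Ioi]
  refine integral_congr_ae (Filter.Eventually.of_forall fun r => ?_)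
  by_cases hr : 0 < r
  -- The slice |u| < r is written as `Ioc (-r) r` minus a null point, in order to match the
  -- convention of interval integrals.
  · have h2 : ∀ u : ℝ, Set.indicator {z : ℝ × ℝ | |z.2| < z.1}
        (fun z => (ENNReal.ofReal (2 * Real.pi * z.1)).toReal • G z) (r, u) =
        Set.indicator (Set.Ioc (-r) r \ {r}) (fun u => (2 * Real.pi * r) • G (r, u)) u := by
      intro u
      have h3 : |u| < r ↔ u ∈ Set.Ioc (-r) r \ {r} := by
        simp only [abs_lt, Set.mem_sdiff, Set.mem_Ioc, Set.mem_singleton_iff]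
        constructor
        · rintro ⟨h, h'⟩; exact ⟨⟨h, h'.le⟩, h'.ne⟩
        · rintro ⟨⟨h, h'⟩, h''⟩; exact ⟨h, lt_of_le_of_ne h' h''⟩
      by_cases hu : |u| < r
      · rw [Set.indicator_of_mem (h3.1 hu), Set.indicator_of_mem (show (r, u) ∈ {z : ℝ × ℝ | |z.2| < z.1} from hu),
          ENNReal.toReal_ofReal (by positivity)]
      · rw [Set.indicator_of_notMem (fun h => hu (h3.2 h)),
          Set.indicator_of_notMem (show (r, u) ∉ {z : ℝ × ℝ | |z.2| < z.1} from hu)]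
    simp only [h2]
    rw [Set.indicator_of_mem (Set.mem_Ioi.2 hr),
      integral_indicator (measurableSet_Ioc.diff (measurableSet_singleton r)),
      setIntegral_congr_set (sdiff_null_ae_eq_self (by simp)),
      ← intervalIntegral.integral_of_le (by linarith), intervalIntegral.integral_smul]
    simp only [hG, intervalIntegral.integral_smul_const]
    have h4 : ∫ u in (-r)..r, Complex.exp (((-2 * Real.pi * (k * u) : ℝ) : ℂ) * Complex.I) =
        ((Real.sin (2 * Real.pi * k * r) / (Real.pi * k) : ℝ) : ℂ) := by
      have hc : (-2 * Real.pi * k * Complex.I : ℂ) ≠ 0 := by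
        simp [Real.pi_ne_zero, hk.ne']
      have h5 := integral_exp_mul_complex (a := -r) (b := r) hc
      have h6 : ∀ u : ℝ, Complex.exp (((-2 * Real.pi * (k * u) : ℝ) : ℂ) * Complex.I) =
          Complex.exp (-2 * Real.pi * k * Complex.I * u) := by
        intro u; congr 1; push_cast; ring
      simp only [h6, h5]
      push_cast
      rw [Complex.sin]
      have hpi : (Real.pi : ℂ) ≠ 0 := by simp [Real.pi_ne_zero]
      have hkc : (k : ℂ) ≠ 0 := by simpa using hk.ne'
      have hI2 : Complex.I ^ 2 = -1 := Complex.I_sq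
      rw [show (-2 * (Real.pi : ℂ) * k * Complex.I * r) = -(2 * Real.pi * k * r) * Complex.I by ring,
        show (-2 * (Real.pi : ℂ) * k * Complex.I * -r) = (2 * Real.pi * k * r) * Complex.I by ring]
      field_simp
      linear_combination (-(Complex.exp (-(2 * Real.pi * k * r * Complex.I)) -
        Complex.exp (2 * Real.pi * k * r * Complex.I))) * hI2
    rw [h4]
    simp only [smul_eq_mul, Complex.real_smul]
    have hpi : (Real.pi : ℂ) ≠ 0 := by simp [Real.pi_ne_zero]
    have hkc : (k : ℂ) ≠ 0 := by simpa using hk.ne'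
    push_cast
    field_simp
  · rw [Set.indicator_of_notMem (by simpa using hr)]
    have h2 : ∀ u : ℝ, (r, u) ∉ {z : ℝ × ℝ | |z.2| < z.1} :=
      fun u h => hr ((abs_nonneg u).trans_lt h)
    simp [Set.indicator_of_notMem (h2 _)]

/-! ### Pairings with Schwartz functions, the multiplication formula and Plancherel. -/

lemma exists_schwartz_eq_ofReal {g : Space → ℝ} (hg : ContDiff ℝ (⊤ : ℕ∞) g) (hc : HasCompactSupport g) :
    ∃ φ : 𝓢(Space, ℂ), ∀ x, φ x = (g x : ℂ) := by
  have h1 : HasCompactSupport fun x => (g x : ℂ) := hc.comp_left (g := Complex.ofReal) (by simp)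
  have h2 : ContDiff ℝ (⊤ : ℕ∞) fun x => (g x : ℂ) := Complex.ofRealCLM.contDiff.comp hg
  exact ⟨h1.toSchwartzMap h2, fun x => rfl⟩

/-- Test against a bump function equal to 1 on the unit ball around each point. -/
lemma locallyIntegrable_of_integrable_mul_schwartz {f : Space → ℂ}
    (hf : ∀ φ : 𝓢(Space, ℂ), Integrable fun x => f x * φ x) : LocallyIntegrable f := by
  intro x
  let b : ContDiffBump x := ⟨1, 2, one_pos, one_lt_two⟩
  obtain ⟨φ, hφ⟩ := exists_schwartz_eq_ofReal (g := b) b.contDiff b.hasCompactSupport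
  refine ⟨Metric.closedBall x 1, Metric.closedBall_mem_nhds x one_pos, ?_⟩
  refine (hf φ).integrableOn.congr_fun (fun y hy => ?_) measurableSet_closedBall
  simp only [hφ]
  rw [b.one_of_mem_closedBall hy]
  simp

/-- A function on `ℝ³` is determined almost everywhere by its pairings with Schwartz functions. -/
lemma ae_eq_of_forall_integral_mul_schwartz_eq {f g : Space → ℂ}
    (hf : LocallyIntegrable f) (hg : LocallyIntegrable g)
    (h : ∀ φ : 𝓢(Space, ℂ), ∫ x, f x * φ x = ∫ x, g x * φ x) : f =ᵐ[volume] g := by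
  refine ae_eq_of_integral_contDiff_smul_eq hf hg fun k hk hkc => ?_
  obtain ⟨φ, hφ⟩ := exists_schwartz_eq_ofReal hk hkc
  have := h φ
  simpa only [hφ, Complex.real_smul, mul_comm] using this

lemma integral_fourier_mul_eq {f g : Space → ℂ} (hf : Integrable f) (hg : Integrable g) :
    ∫ ξ, 𝓕 f ξ * g ξ = ∫ x, f x * 𝓕 g x := by
  have := VectorFourier.integral_fourierIntegral_smul_eq_flip (μ := (volume : Measure Space))
    (ν := (volume : Measure Space)) (L := innerₗ Space) Real.continuous_fourierChar
    continuous_inner hf hg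
  simp only [smul_eq_mul, flip_innerₗ] at this
  exact this

/-- The L² transform and the integral transform define the same tempered distribution, by the
multiplication formula, hence agree almost everywhere. -/
lemma coeFn_fourier_toLp {g : Space → ℂ} (h1 : Integrable g) (h2 : MemLp g 2) :
    (𝓕 (h2.toLp g) : Lp ℂ 2 (volume : Measure Space)) =ᵐ[volume] 𝓕 g := by
  have hc : Continuous (𝓕 g) := VectorFourier.fourierIntegral_continuous
    Real.continuous_fourierChar (by exact continuous_inner) h1
  refine ae_eq_of_forall_integral_mul_schwartz_eq ?_ hc.locallyIntegrable fun φ => ?_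
  · exact (Lp.memLp _).locallyIntegrable (by norm_num)
  · have h := congrArg (fun T : 𝓢'(Space, ℂ) => T φ)
      (Lp.fourier_toTemperedDistribution_eq (h2.toLp g))
    simp only [TemperedDistribution.fourier_apply, Lp.toTemperedDistribution_apply, smul_eq_mul] at h
    rw [integral_fourier_mul_eq h1 φ.integrable, ← SchwartzMap.fourier_coe]
    calc _ = ∫ x, φ x * (𝓕 (h2.toLp g) : Lp ℂ 2 (volume : Measure Space)) x := by
          simp only [mul_comm]
      _ = _ := h.symm
      _ = _ := by
          refine integral_congr_ae ?_
          filter_upwards [h2.coeFn_toLp] with x hx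
          rw [hx, mul_comm]

/-- Plancherel's identity for functions in `L¹ ∩ L²`. -/
lemma integral_conj_fourier_mul_fourier {f g : Space → ℂ} (hf : Integrable f) (hf2 : MemLp f 2)
    (hg : Integrable g) (hg2 : MemLp g 2) :
    ∫ ξ, (starRingEnd ℂ) (𝓕 f ξ) * 𝓕 g ξ = ∫ x, (starRingEnd ℂ) (f x) * g x := by
  have h := MeasureTheory.Lp.inner_fourier_eq (hf2.toLp f) (hg2.toLp g)
  rw [MeasureTheory.L2.inner_def, MeasureTheory.L2.inner_def] at h
  have e1 : ∫ ξ, (starRingEnd ℂ) (𝓕 f ξ) * 𝓕 g ξ = ∫ a, inner ℂ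
      ((𝓕 (hf2.toLp f) : Lp ℂ 2 (volume : Measure Space)) a)
      ((𝓕 (hg2.toLp g) : Lp ℂ 2 (volume : Measure Space)) a) := by
    refine integral_congr_ae ?_
    filter_upwards [coeFn_fourier_toLp hf hf2, coeFn_fourier_toLp hg hg2] with x h1 h2
    rw [h1, h2, RCLike.inner_apply, mul_comm]
  rw [e1, h]
  refine integral_congr_ae ?_
  filter_upwards [hf2.coeFn_toLp, hg2.coeFn_toLp] with x h1 h2
  rw [h1, h2, RCLike.inner_apply, mul_comm]

/-! ### Integrability of radial functions and two Laplace-type integrals. -/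

lemma integrable_radial_iff {F : ℝ → ℂ} (hF : Measurable F) :
    (Integrable fun x : Space => F ‖x‖) ↔
      IntegrableOn (fun r : ℝ => (4 * Real.pi * r ^ 2) • F r) (Set.Ioi 0) := by
  rw [← integrable_radialMeasure]
  exact measurePreserving_norm.integrable_comp hF.aestronglyMeasurable

lemma integrable_radial_of_le_exp {F : ℝ → ℂ} (hF : Measurable F) {C : ℝ}
    (h : ∀ r, 0 < r → r ^ 2 * ‖F r‖ ≤ C * Real.exp (-r)) :
    Integrable fun x : Space => F ‖x‖ := by
  rw [integrable_radial_iff hF]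
  have h1 : IntegrableOn (fun r : ℝ => 4 * Real.pi * C * Real.exp (-r)) (Set.Ioi 0) :=
    (integrableOn_exp_neg_Ioi 0).const_mul _
  refine Integrable.mono' h1 ?_ ?_
  · exact ((by fun_prop : Measurable fun r : ℝ => 4 * Real.pi * r ^ 2).smul hF).aestronglyMeasurable
  · refine (ae_restrict_iff' measurableSet_Ioi).2 (Filter.Eventually.of_forall fun r hr => ?_)
    rw [norm_smul, Real.norm_of_nonneg (by positivity)]
    have := h r hr
    have hpi := Real.pi_pos
    nlinarith

lemma memLp_two_radial_of_le_exp {F : ℝ → ℂ} (hF : Measurable F) {C : ℝ}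
    (h : ∀ r, 0 < r → (r * ‖F r‖) ^ 2 ≤ C * Real.exp (-r)) :
    MemLp (fun x : Space => F ‖x‖) 2 := by
  have hm : AEStronglyMeasurable (fun x : Space => F ‖x‖) volume :=
    (hF.comp measurable_norm).aestronglyMeasurable
  rw [memLp_two_iff_integrable_sq_norm hm]
  have := integrable_radial_of_le_exp (F := fun r => ((‖F r‖ ^ 2 : ℝ) : ℂ)) (by fun_prop) (C := C) (by
    intro r hr
    have := h r hr
    rw [Complex.norm_real, Real.norm_of_nonneg (by positivity)]
    linarith)
  simpa only [RCLike.re_to_complex, Complex.ofReal_re] using this.re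

lemma tendsto_exp_neg_mul_of_bounded {f : ℝ → ℝ} {C : ℝ} (hf : ∀ s, 0 ≤ s → |f s| ≤ C * (1 + s)) :
    Filter.Tendsto (fun s => -(Real.exp (-s) * f s)) Filter.atTop (nhds 0) := by
  have h1 : Filter.Tendsto (fun s : ℝ => C * (s ^ 0 * Real.exp (-s) + s ^ 1 * Real.exp (-s)))
      Filter.atTop (nhds 0) := by
    simpa using ((Real.tendsto_pow_mul_exp_neg_atTop_nhds_zero 0).add
      (Real.tendsto_pow_mul_exp_neg_atTop_nhds_zero 1)).const_mul C
  refine squeeze_zero_norm' ?_ h1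
  filter_upwards [Filter.eventually_ge_atTop 0] with s hs
  rw [norm_neg, norm_mul, Real.norm_eq_abs, Real.norm_eq_abs, abs_of_pos (Real.exp_pos _)]
  have := mul_le_mul_of_nonneg_left (hf s hs) (Real.exp_pos (-s)).le
  linarith

lemma abs_mul_sin_add_mul_cos_le (A B x : ℝ) :
    |A * Real.sin x + B * Real.cos x| ≤ |A| + |B| := by
  refine (abs_add_le _ _).trans ?_
  rw [abs_mul, abs_mul]
  have h1 := mul_le_mul_of_nonneg_left (Real.abs_sin_le_one x) (abs_nonneg A)
  have h2 := mul_le_mul_of_nonneg_left (Real.abs_cos_le_one x) (abs_nonneg B)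
  linarith

lemma integrableOn_exp_neg_mul_sin (p θ : ℝ) :
    IntegrableOn (fun s => Real.exp (-s) * Real.sin (p * s - θ)) (Set.Ioi 0) := by
  refine (integrableOn_exp_neg_Ioi 0).mono' (by fun_prop) (Filter.Eventually.of_forall fun s => ?_)
  rw [norm_mul, Real.norm_of_nonneg (Real.exp_pos _).le]
  exact mul_le_of_le_one_right (Real.exp_pos _).le (Real.abs_sin_le_one _)

/-- The primitive is the imaginary part of -e^{-iθ} e^{-zs}/z with z = 1 - ip. -/
lemma integral_exp_neg_mul_sin (p θ : ℝ) :
    ∫ s in Set.Ioi (0 : ℝ), Real.exp (-s) * Real.sin (p * s - θ) =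
      (p * Real.cos θ - Real.sin θ) / (1 + p ^ 2) := by
  have hp : 0 < 1 + p ^ 2 := by positivity
  have h := integral_Ioi_of_hasDerivAt_of_tendsto' (a := 0) (m := 0)
    (f := fun s => -(Real.exp (-s) * (((1 + p ^ 2)⁻¹) * Real.sin (p * s - θ) +
      (p * (1 + p ^ 2)⁻¹) * Real.cos (p * s - θ))))
    (f' := fun s => Real.exp (-s) * Real.sin (p * s - θ)) (fun s _ => by
      have hl : HasDerivAt (fun s : ℝ => p * s - θ) p s := by
        simpa using ((hasDerivAt_id s).const_mul p).sub_const θ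
      have := (((hasDerivAt_neg s).exp).mul ((hl.sin.const_mul ((1 + p ^ 2)⁻¹)).add
        (hl.cos.const_mul (p * (1 + p ^ 2)⁻¹)))).neg
      refine this.congr_deriv ?_
      simp only [Pi.add_apply]
      field_simp
      ring) (integrableOn_exp_neg_mul_sin p θ)
    (tendsto_exp_neg_mul_of_bounded (C := |(1 + p ^ 2)⁻¹| + |p * (1 + p ^ 2)⁻¹|) fun s hs =>
      (abs_mul_sin_add_mul_cos_le _ _ _).trans (le_mul_of_one_le_right (by positivity) (by linarith)))
  rw [h]
  simp
  field_simp
  ring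

lemma integrableOn_mul_exp_neg_mul_sin (k : ℝ) :
    IntegrableOn (fun s => s * Real.exp (-s) * Real.sin (k * s)) (Set.Ioi 0) := by
  have h : IntegrableOn (fun s : ℝ => s * Real.exp (-s)) (Set.Ioi 0) := by
    have := Real.GammaIntegral_convergent (s := 2) two_pos
    refine this.congr_fun (fun s hs => ?_) measurableSet_Ioi
    norm_num
    ring
  refine h.mono' (by fun_prop) ((ae_restrict_iff' measurableSet_Ioi).2
    (Filter.Eventually.of_forall fun s hs => ?_))
  have hs : 0 < s := hs
  rw [norm_mul, Real.norm_of_nonneg (by positivity)]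
  exact mul_le_of_le_one_right (by positivity) (Real.abs_sin_le_one _)

/-- The primitive is the imaginary part of -e^{-zs}(s/z + 1/z²) with z = 1 - ik; expanding 1/z = c(1
+ ik) gives the coefficients. -/
lemma integral_mul_exp_neg_mul_sin (k : ℝ) :
    ∫ s in Set.Ioi (0 : ℝ), s * Real.exp (-s) * Real.sin (k * s) = 2 * k / (1 + k ^ 2) ^ 2 := by
  have hp : 0 < 1 + k ^ 2 := by positivity
  set c := (1 + k ^ 2)⁻¹ with hc
  have hck : c * (1 + k ^ 2) = 1 := inv_mul_cancel₀ hp.ne'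
  have h := integral_Ioi_of_hasDerivAt_of_tendsto' (a := 0) (m := 0)
    (f := fun s => -(Real.exp (-s) * ((s * c + (1 - k ^ 2) * c ^ 2) * Real.sin (k * s) +
      (s * (k * c) + 2 * k * c ^ 2) * Real.cos (k * s))))
    (f' := fun s => s * Real.exp (-s) * Real.sin (k * s)) (fun s _ => by
      have hl : HasDerivAt (fun s : ℝ => k * s) k s := by
        simpa using ((hasDerivAt_id s).const_mul k)
      have h1 : HasDerivAt (fun s : ℝ => s * c + (1 - k ^ 2) * c ^ 2) c s := by
        simpa using ((hasDerivAt_id s).mul_const c).add_const ((1 - k ^ 2) * c ^ 2)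
      have h2 : HasDerivAt (fun s : ℝ => s * (k * c) + 2 * k * c ^ 2) (k * c) s := by
        simpa using ((hasDerivAt_id s).mul_const (k * c)).add_const (2 * k * c ^ 2)
      have := (((hasDerivAt_neg s).exp).mul ((h1.mul hl.sin).add (h2.mul hl.cos))).neg
      refine this.congr_deriv ?_
      simp only [Pi.add_apply, Pi.mul_apply, hc]
      field_simp
      ring) (integrableOn_mul_exp_neg_mul_sin k)
    (tendsto_exp_neg_mul_of_bounded
      (C := (|c| + |(1 - k ^ 2) * c ^ 2|) + (|k * c| + |2 * k * c ^ 2|)) fun s hs => by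
      refine (abs_mul_sin_add_mul_cos_le _ _ _).trans ?_
      have h1 := abs_add_le (s * c) ((1 - k ^ 2) * c ^ 2)
      have h2 := abs_add_le (s * (k * c)) (2 * k * c ^ 2)
      rw [abs_mul s, abs_of_nonneg hs] at h1 h2
      have := mul_nonneg hs (abs_nonneg c)
      nlinarith [abs_nonneg c, abs_nonneg (k * c), mul_nonneg hs (abs_nonneg ((1 - k ^ 2) * c ^ 2)),
        mul_nonneg hs (abs_nonneg (2 * k * c ^ 2))])
  rw [h]
  simp [hc]
  field_simp

/-! ### The linear wave and its spectral profile. -/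

/-- The conformal factor as a function of time and radius. -/
noncomputable def radialConformalFactor (t r : ℝ) : ℝ :=
  2 / (√(1 + (t + r) ^ 2) * √(1 + (t - r) ^ 2))

/-- The radial profile of the wave with Penrose transform `cos (T - θ)`. -/
noncomputable def waveProfile (θ t r : ℝ) : ℝ :=
  radialConformalFactor t r * Real.cos (Real.arctan (t + r) + Real.arctan (t - r) - θ)

/-- The sines and cosines of the two arctangents supply exactly the square roots that complete those
in Ω. The resulting rational form is what the sine transform produces. -/
lemma waveProfile_eq (θ t r : ℝ) : waveProfile θ t r =
    2 * ((1 - (t + r) * (t - r)) * Real.cos θ + ((t + r) + (t - r)) * Real.sin θ) /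
      ((1 + (t + r) ^ 2) * (1 + (t - r) ^ 2)) := by
  have h1 : 0 < 1 + (t + r) ^ 2 := by positivity
  have h2 : 0 < 1 + (t - r) ^ 2 := by positivity
  rw [waveProfile, radialConformalFactor, Real.cos_sub, Real.cos_add, Real.sin_add,
    Real.cos_arctan, Real.cos_arctan, Real.sin_arctan, Real.sin_arctan]
  have e1 := Real.sq_sqrt h1.le
  have e2 := Real.sq_sqrt h2.le
  have p1 := Real.sqrt_pos.2 h1
  have p2 := Real.sqrt_pos.2 h2
  set A := √(1 + (t + r) ^ 2)
  set B := √(1 + (t - r) ^ 2)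
  rw [← e1, ← e2]
  field_simp

/-- The radial profile of the Fourier transform of the wave at time `t`. -/
noncomputable def spectralProfile (θ t r : ℝ) : ℂ :=
  ((2 * Real.pi * Real.exp (-(2 * Real.pi * r)) / r * Real.cos (t * (2 * Real.pi * r) - θ) : ℝ) : ℂ)

lemma measurable_spectralProfile (θ t : ℝ) : Measurable (spectralProfile θ t) := by
  unfold spectralProfile
  fun_prop

lemma norm_spectralProfile_le (θ t : ℝ) {r : ℝ} (hr : 0 < r) :
    r * ‖spectralProfile θ t r‖ ≤ 2 * Real.pi * Real.exp (-(2 * Real.pi * r)) := by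
  rw [spectralProfile, Complex.norm_real, norm_mul, Real.norm_of_nonneg (by positivity)]
  have := mul_le_mul_of_nonneg_left (Real.abs_cos_le_one (t * (2 * Real.pi * r) - θ))
    (by positivity : 0 ≤ 2 * Real.pi * Real.exp (-(2 * Real.pi * r)))
  rw [Real.norm_eq_abs]
  calc _ = 2 * Real.pi * Real.exp (-(2 * Real.pi * r)) * |Real.cos (t * (2 * Real.pi * r) - θ)| := by
        field_simp
    _ ≤ _ := by linarith

lemma integrable_spectralProfile (θ t : ℝ) :
    Integrable fun ξ : Space => spectralProfile θ t ‖ξ‖ := by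
  refine integrable_radial_of_le_exp (measurable_spectralProfile θ t) (C := 2 * Real.pi) fun r hr => ?_
  have h := mul_le_mul_of_nonneg_left (norm_spectralProfile_le θ t hr) hr.le
  have h1 : r ≤ Real.exp r := by linarith [Real.add_one_le_exp r]
  have h2 : r * Real.exp (-(2 * Real.pi * r)) ≤ Real.exp (-r) := by
    calc _ ≤ Real.exp r * Real.exp (-(2 * Real.pi * r)) := by gcongr
      _ = Real.exp (r - 2 * Real.pi * r) := by rw [← Real.exp_add]; ring_nf
      _ ≤ _ := Real.exp_le_exp.2 (by nlinarith [Real.pi_gt_three])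
  nlinarith [Real.pi_pos]

lemma memLp_spectralProfile (θ t : ℝ) :
    MemLp (fun ξ : Space => spectralProfile θ t ‖ξ‖) 2 := by
  refine memLp_two_radial_of_le_exp (measurable_spectralProfile θ t) (C := (2 * Real.pi) ^ 2)
    fun r hr => ?_
  refine (pow_le_pow_left₀ (by positivity) (norm_spectralProfile_le θ t hr) 2).trans ?_
  rw [mul_pow, ← Real.exp_nat_mul]
  gcongr
  push_cast
  nlinarith [Real.pi_gt_three]

/-- The transform is taken from frequency to space: the spectral profile is in L¹, whereas 2/(1 +
|x|²), the profile for θ = t = 0, is not integrable on ℝ³. -/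
lemma fourier_spectralProfile (θ t : ℝ) {x : Space} (hx : x ≠ 0) :
    𝓕 (fun ξ : Space => spectralProfile θ t ‖ξ‖) x = (waveProfile θ t ‖x‖ : ℂ) := by
  rw [fourier_radial (measurable_spectralProfile θ t) (integrable_spectralProfile θ t) hx]
  have hk : 0 < ‖x‖ := norm_pos_iff.2 hx
  set k := ‖x‖
  have hpi := Real.pi_pos
  -- The factor r cancels the singularity 1/r, a product-to-sum formula separates t + k from t - k,
  -- and s = 2πr.
  have h1 : ∫ r in Set.Ioi (0 : ℝ), ((r * Real.sin (2 * Real.pi * k * r) : ℝ) : ℂ) *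
      spectralProfile θ t r = ((∫ r in Set.Ioi (0 : ℝ), (fun s => Real.pi *
        (Real.exp (-s) * Real.sin ((t + k) * s - θ) - Real.exp (-s) * Real.sin ((t - k) * s - θ)))
          (2 * Real.pi * r) : ℝ) : ℂ) := by
    rw [← integral_complex_ofReal]
    refine setIntegral_congr_fun measurableSet_Ioi fun r hr => ?_
    have hr : 0 < r := hr
    simp only [spectralProfile]
    rw [← Complex.ofReal_mul]
    congr 1
    have e1 : (t + k) * (2 * Real.pi * r) - θ = (t * (2 * Real.pi * r) - θ) + 2 * Real.pi * k * r := by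
      ring
    have e2 : (t - k) * (2 * Real.pi * r) - θ = (t * (2 * Real.pi * r) - θ) - 2 * Real.pi * k * r := by
      ring
    rw [e1, e2]
    generalize t * (2 * Real.pi * r) - θ = α
    generalize 2 * Real.pi * k * r = β
    rw [Real.sin_add, Real.sin_sub]
    field_simp
    ring
  have h2 := integral_comp_mul_left_Ioi (fun s => Real.pi * (Real.exp (-s) *
    Real.sin ((t + k) * s - θ) - Real.exp (-s) * Real.sin ((t - k) * s - θ))) 0
    (by positivity : 0 < 2 * Real.pi)
  rw [h1, h2, ← Complex.ofReal_mul, mul_zero, integral_const_mul, integral_sub (integrableOn_exp_neg_mul_sin _ _)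
    (integrableOn_exp_neg_mul_sin _ _), integral_exp_neg_mul_sin, integral_exp_neg_mul_sin,
    waveProfile_eq]
  congr 1
  have a1 : 0 < 1 + (t + k) ^ 2 := by positivity
  have a2 : 0 < 1 + (t - k) ^ 2 := by positivity
  rw [smul_eq_mul]
  field_simp
  ring

/-- Pairing of a Fourier multiplier applied to a Schwartz function with the Fourier transform of a
real radial function. -/
lemma integral_mul_fourierInv_multiplier {γ : ℝ → ℂ} (hγr : ∀ r, (starRingEnd ℂ) (γ r) = γ r)
    (h1 : Integrable fun ξ : Space => γ ‖ξ‖) (h2 : MemLp (fun ξ : Space => γ ‖ξ‖) 2)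
    {f : Space → ℝ} (hf : ∀ᵐ x, 𝓕 (fun ξ : Space => γ ‖ξ‖) x = (f x : ℂ))
    {m : ℝ → ℝ} (hm : Measurable m) {C : ℝ} (hC : ∀ r, |m r| ≤ C) (φ : 𝓢(Space, ℂ)) :
    ∫ x, (f x : ℂ) * 𝓕⁻ (fun ξ : Space => (m ‖ξ‖ : ℂ) * 𝓕 (φ : Space → ℂ) ξ) x =
      ∫ ξ, γ ‖ξ‖ * ((m ‖ξ‖ : ℂ) * 𝓕 (φ : Space → ℂ) ξ) := by
  set ψ : Space → ℂ := fun ξ => (m ‖ξ‖ : ℂ) * 𝓕 (φ : Space → ℂ) (-ξ) with hψ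
  set φ' : Space → ℂ := fun ξ => 𝓕 (φ : Space → ℂ) (-ξ) with hφ'
  have hmm : AEStronglyMeasurable (fun ξ : Space => (m ‖ξ‖ : ℂ)) volume :=
    (by fun_prop : Measurable fun ξ : Space => (m ‖ξ‖ : ℂ)).aestronglyMeasurable
  have hmb : ∀ ξ : Space, ‖(m ‖ξ‖ : ℂ)‖ ≤ C := fun ξ => by
    rw [Complex.norm_real]; exact hC _
  have hφ1 : Integrable φ' := by
    have := (𝓕 φ).integrable (μ := volume)
    rw [SchwartzMap.fourier_coe] at this
    exact this.comp_neg
  have hφ2 : MemLp φ' 2 := by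
    have := (𝓕 φ).memLp 2 (μ := volume)
    rw [SchwartzMap.fourier_coe] at this
    exact this.comp_measurePreserving (Measure.measurePreserving_neg volume)
  have hψ1 : Integrable ψ := hφ1.bdd_mul hmm (Filter.Eventually.of_forall hmb)
  have hψ2 : MemLp ψ 2 := by
    refine (hφ2.const_mul (C : ℂ)).mono (hmm.mul hφ2.1) (Filter.Eventually.of_forall fun ξ => ?_)
    calc ‖ψ ξ‖ = ‖(m ‖ξ‖ : ℂ)‖ * ‖φ' ξ‖ := norm_mul _ _
      _ ≤ |C| * ‖φ' ξ‖ :=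
        mul_le_mul_of_nonneg_right ((hmb ξ).trans (le_abs_self C)) (norm_nonneg _)
      _ = ‖(C : ℂ) * φ' ξ‖ := by rw [norm_mul, Complex.norm_real, Real.norm_eq_abs]
  have hinv : 𝓕⁻ (fun ξ : Space => (m ‖ξ‖ : ℂ) * 𝓕 (φ : Space → ℂ) ξ) = 𝓕 ψ := by
    ext x
    rw [Real.fourierInv_eq_fourier_comp_neg]
    simp only [hψ, norm_neg]
  -- Plancherel needs only that ψ is in L¹ ∩ L²; no decay of the propagated test function has to be
  -- known.
  have hP := integral_conj_fourier_mul_fourier h1 h2 hψ1 hψ2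
  calc _ = ∫ x, (starRingEnd ℂ) (𝓕 (fun ξ : Space => γ ‖ξ‖) x) * 𝓕 ψ x := by
        refine integral_congr_ae ?_
        filter_upwards [hf] with x hx
        rw [hx, hinv, Complex.conj_ofReal]
    _ = ∫ ξ, (starRingEnd ℂ) (γ ‖ξ‖) * ψ ξ := hP
    _ = _ := by
        rw [← integral_neg_eq_self]
        simp only [hγr, hψ, norm_neg, neg_neg]

lemma ae_ne_zero : ∀ᵐ x : Space, x ≠ 0 := by
  simp [ae_iff]

/-- The radial profile of the Fourier transform of `(2 / (1 + |x|²))²`. -/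
noncomputable def expProfile (r : ℝ) : ℂ :=
  ((4 * Real.pi ^ 2 * Real.exp (-(2 * Real.pi * r)) : ℝ) : ℂ)

lemma measurable_expProfile : Measurable expProfile := by
  unfold expProfile
  fun_prop

lemma sq_mul_exp_le {r : ℝ} (hr : 0 < r) :
    r ^ 2 * Real.exp (-(2 * Real.pi * r)) ≤ 2 * Real.exp (-r) := by
  have h1 : r ^ 2 ≤ 2 * Real.exp r := by
    have := Real.quadratic_le_exp_of_nonneg hr.le
    nlinarith
  calc _ ≤ 2 * Real.exp r * Real.exp (-(2 * Real.pi * r)) := by gcongr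
    _ = 2 * Real.exp (r - 2 * Real.pi * r) := by rw [mul_assoc, ← Real.exp_add]; ring_nf
    _ ≤ _ := by
      gcongr
      nlinarith [Real.pi_gt_three]

lemma integrable_expProfile : Integrable fun ξ : Space => expProfile ‖ξ‖ := by
  refine integrable_radial_of_le_exp measurable_expProfile (C := 8 * Real.pi ^ 2) fun r hr => ?_
  rw [expProfile, Complex.norm_real, Real.norm_of_nonneg (by positivity)]
  have := mul_le_mul_of_nonneg_left (sq_mul_exp_le hr) (by positivity : 0 ≤ 4 * Real.pi ^ 2)
  linarith

lemma memLp_expProfile : MemLp (fun ξ : Space => expProfile ‖ξ‖) 2 := by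
  refine memLp_two_radial_of_le_exp measurable_expProfile (C := 32 * Real.pi ^ 4) fun r hr => ?_
  rw [expProfile, Complex.norm_real, Real.norm_of_nonneg (by positivity)]
  have h1 : Real.exp (-(2 * Real.pi * r)) ≤ 1 := Real.exp_le_one_iff.2 (by
    have := Real.pi_pos
    nlinarith [mul_pos this hr])
  have h2 := mul_le_mul (sq_mul_exp_le hr) h1 (Real.exp_pos _).le (by positivity)
  have := mul_le_mul_of_nonneg_left h2 (by positivity : 0 ≤ 16 * Real.pi ^ 4)
  nlinarith

lemma fourier_expProfile {x : Space} (hx : x ≠ 0) :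
    𝓕 (fun ξ : Space => expProfile ‖ξ‖) x = (((2 / (1 + ‖x‖ ^ 2)) ^ 2 : ℝ) : ℂ) := by
  rw [fourier_radial measurable_expProfile integrable_expProfile hx]
  have hk : 0 < ‖x‖ := norm_pos_iff.2 hx
  set k := ‖x‖
  have hpi := Real.pi_pos
  have h1 : ∫ r in Set.Ioi (0 : ℝ), ((r * Real.sin (2 * Real.pi * k * r) : ℝ) : ℂ) *
      expProfile r = ((∫ r in Set.Ioi (0 : ℝ), (fun s => 2 * Real.pi *
        (s * Real.exp (-s) * Real.sin (k * s))) (2 * Real.pi * r) : ℝ) : ℂ) := by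
    rw [← integral_complex_ofReal]
    refine setIntegral_congr_fun measurableSet_Ioi fun r hr => ?_
    simp only [expProfile]
    rw [← Complex.ofReal_mul]
    congr 1
    rw [show k * (2 * Real.pi * r) = 2 * Real.pi * k * r by ring]
    ring
  have h2 := integral_comp_mul_left_Ioi (fun s => 2 * Real.pi *
    (s * Real.exp (-s) * Real.sin (k * s))) 0 (by positivity : 0 < 2 * Real.pi)
  rw [h1, h2, ← Complex.ofReal_mul, mul_zero, integral_const_mul, integral_mul_exp_neg_mul_sin]
  congr 1
  rw [smul_eq_mul]
  field_simp

lemma waveProfile_zero_zero (r : ℝ) : waveProfile 0 0 r = 2 / (1 + r ^ 2) := by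
  rw [waveProfile_eq]
  simp
  field_simp

lemma abs_mul_sinc_le (t y : ℝ) : |t * Real.sinc y| ≤ |t| := by
  rw [abs_mul]
  exact mul_le_of_le_one_right (abs_nonneg t) (Real.abs_sinc_le_one y)

/-- All three pairings are moved to the frequency side, where the identity becomes a pointwise one
between multipliers. -/
lemma integral_waveProfile_mul (θ t : ℝ) (φ : 𝓢(Space, ℂ)) :
    ∫ x : Space, (waveProfile θ t ‖x‖ : ℂ) * φ x =
      (∫ x : Space, (data₀ θ x : ℂ) * cosPropagator t φ x) +
        ∫ x : Space, (data₁ θ x : ℂ) * sinPropagator t φ x := by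
  have hc := integral_mul_fourierInv_multiplier (γ := spectralProfile 0 0) (fun r => by
    rw [spectralProfile, Complex.conj_ofReal]) (integrable_spectralProfile 0 0)
    (memLp_spectralProfile 0 0) (f := fun x => 2 / (1 + ‖x‖ ^ 2)) (by
      filter_upwards [ae_ne_zero] with x hx
      rw [fourier_spectralProfile 0 0 hx, waveProfile_zero_zero])
    (m := fun r => Real.cos (t * (2 * Real.pi * r))) (by fun_prop) (C := 1)
    (fun r => Real.abs_cos_le_one _) φ
  have hs := integral_mul_fourierInv_multiplier (γ := expProfile) (fun r => by
    rw [expProfile, Complex.conj_ofReal]) integrable_expProfile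
    memLp_expProfile (f := fun x => (2 / (1 + ‖x‖ ^ 2)) ^ 2) (by
      filter_upwards [ae_ne_zero] with x hx
      rw [fourier_expProfile hx])
    (m := fun r => t * Real.sinc (t * (2 * Real.pi * r))) (by fun_prop) (C := |t|)
    (fun r => abs_mul_sinc_le _ _) φ
  have e0 : ∫ x : Space, (data₀ θ x : ℂ) * cosPropagator t φ x = (Real.cos θ : ℂ) *
      ∫ ξ : Space, spectralProfile 0 0 ‖ξ‖ * ((Real.cos (t * (2 * Real.pi * ‖ξ‖)) : ℝ) *
        𝓕 (φ : Space → ℂ) ξ) := by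
    rw [← hc, ← integral_const_mul]
    refine integral_congr_ae (Filter.Eventually.of_forall fun x => ?_)
    simp only [data₀, cosPropagator, Complex.ofReal_mul, mul_assoc]
  have e1 : ∫ x : Space, (data₁ θ x : ℂ) * sinPropagator t φ x = (Real.sin θ : ℂ) *
      ∫ ξ : Space, expProfile ‖ξ‖ * ((t * Real.sinc (t * (2 * Real.pi * ‖ξ‖)) : ℝ) *
        𝓕 (φ : Space → ℂ) ξ) := by
    rw [← hs, ← integral_const_mul]
    refine integral_congr_ae (Filter.Eventually.of_forall fun x => ?_)
    simp only [data₁, sinPropagator, Complex.ofReal_mul, mul_assoc]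
  have hφ : Integrable fun ξ : Space => 𝓕 (φ : Space → ℂ) ξ := by
    have := (𝓕 φ).integrable (μ := volume)
    rwa [SchwartzMap.fourier_coe] at this
  have hbd : ∃ B, ∀ ξ : Space, ‖𝓕 (φ : Space → ℂ) ξ‖ ≤ B := by
    refine ⟨∫ x, ‖φ x‖, fun ξ => ?_⟩
    exact VectorFourier.norm_fourierIntegral_le_integral_norm _ _ _ _ _
  obtain ⟨B, hB⟩ := hbd
  have hi : ∀ {γ : ℝ → ℂ}, (Integrable fun ξ : Space => γ ‖ξ‖) → ∀ {m : ℝ → ℝ}, Measurable m →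
      ∀ {C : ℝ}, (∀ r, |m r| ≤ C) →
      Integrable fun ξ : Space => γ ‖ξ‖ * ((m ‖ξ‖ : ℂ) * 𝓕 (φ : Space → ℂ) ξ) := by
    intro γ hγ m hm C hC
    refine hγ.mul_bdd (c := C * B) ?_ (Filter.Eventually.of_forall fun ξ => ?_)
    · exact (by fun_prop : Measurable fun ξ : Space => (m ‖ξ‖ : ℂ)).aestronglyMeasurable.mul hφ.1
    · rw [norm_mul, Complex.norm_real]
      exact mul_le_mul (hC _) (hB _) (norm_nonneg _) ((abs_nonneg _).trans (hC 0))
  have ic := hi (integrable_spectralProfile 0 0) (m := fun r => Real.cos (t * (2 * Real.pi * r)))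
    (by fun_prop) (C := 1) (fun r => Real.abs_cos_le_one _)
  have is := hi integrable_expProfile (m := fun r => t * Real.sinc (t * (2 * Real.pi * r)))
    (by fun_prop) (C := |t|) (fun r => abs_mul_sinc_le _ _)
  rw [e0, e1, ← integral_const_mul, ← integral_const_mul, ← integral_add (ic.const_mul _)
    (is.const_mul _)]
  calc _ = ∫ x : Space, 𝓕 (fun ξ : Space => spectralProfile θ t ‖ξ‖) x * φ x := by
        refine integral_congr_ae ?_
        filter_upwards [ae_ne_zero] with x hx
        rw [fourier_spectralProfile θ t hx]
    _ = ∫ ξ : Space, spectralProfile θ t ‖ξ‖ * 𝓕 (φ : Space → ℂ) ξ :=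
        integral_fourier_mul_eq (integrable_spectralProfile θ t) φ.integrable
    _ = _ := by
        refine integral_congr_ae ?_
        filter_upwards [ae_ne_zero] with ξ hξ
        have hr : 0 < ‖ξ‖ := norm_pos_iff.2 hξ
        set r := ‖ξ‖
        -- This is cos(tρ - θ) = cos θ cos tρ + sin θ sin tρ with ρ = 2πr, after dividing 4π² e^{-ρ}
        -- by ρ.
        suffices hkey : spectralProfile θ t r = (Real.cos θ : ℂ) * (spectralProfile 0 0 r *
            (Real.cos (t * (2 * Real.pi * r)) : ℝ)) + (Real.sin θ : ℂ) * (expProfile r *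
            (t * Real.sinc (t * (2 * Real.pi * r)) : ℝ)) by
          rw [hkey]
          ring
        simp only [spectralProfile, expProfile]
        rw [← Complex.ofReal_mul, ← Complex.ofReal_mul, ← Complex.ofReal_mul, ← Complex.ofReal_mul,
          ← Complex.ofReal_add]
        congr 1
        have hsinc : t * Real.sinc (t * (2 * Real.pi * r)) * (2 * Real.pi * r) =
            Real.sin (t * (2 * Real.pi * r)) := by
          by_cases ht : t = 0
          · simp [ht]
          · rw [Real.sinc_of_ne_zero (by simp [ht, Real.pi_ne_zero, hr.ne'])]
            have := Real.pi_pos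
            field_simp
        rw [Real.cos_sub, ← hsinc]
        simp
        field_simp
        ring

/-! ### Window integrals and the radial Kirchhoff formula. -/

/-- From r² ≤ 2(r + y)² + 2y²: the weight 1 + r² changes by a bounded factor under shifts of size at
most τ. -/
lemma one_add_sq_le_of_abs_le {r y τ : ℝ} (hy : |y| ≤ τ) :
    1 + r ^ 2 ≤ (2 + 2 * τ ^ 2) * (1 + (r + y) ^ 2) := by
  have h : y ^ 2 ≤ τ ^ 2 := by
    rw [← sq_abs y]
    exact pow_le_pow_left₀ (abs_nonneg y) hy 2
  nlinarith [sq_nonneg (r + 2 * y), mul_nonneg (sq_nonneg τ) (sq_nonneg (r + y))]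

lemma div_one_add_sq_le_of_abs_le {C r y τ : ℝ} (hC : 0 ≤ C) (hy : |y| ≤ τ) :
    C / (1 + (r + y) ^ 2) ≤ C * (2 + 2 * τ ^ 2) / (1 + r ^ 2) := by
  rw [div_le_div_iff₀ (by positivity) (by positivity)]
  have := mul_le_mul_of_nonneg_left (one_add_sq_le_of_abs_le (r := r) hy) hC
  linarith

lemma integrable_const_div_one_add_sq (C : ℝ) : Integrable fun r : ℝ => C / (1 + r ^ 2) := by
  simpa only [div_eq_mul_inv] using integrable_inv_one_add_sq.const_mul C

/-- The integral of `g` over `[r - τ, r + τ]`. For `g ρ = ρ * F ρ` with `F` even it is `2 r τ` times the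
mean of the radial function `F` over a sphere of radius `τ` with centre at distance `r` from `0`. -/
noncomputable def windowIntegral (g : ℝ → ℝ) (τ r : ℝ) : ℝ := ∫ ρ in (r - τ)..(r + τ), g ρ

lemma windowIntegral_eq (g : ℝ → ℝ) (τ r : ℝ) : windowIntegral g τ r = ∫ y in (-τ)..τ, g (r + y) := by
  rw [windowIntegral, intervalIntegral.integral_comp_add_left]
  ring_nf

section Window

variable {g : ℝ → ℝ} {C : ℝ}

lemma continuous_windowIntegral (hg : Continuous g) (τ : ℝ) : Continuous (windowIntegral g τ) := by
  have : windowIntegral g τ = fun r => ∫ y in (-τ)..τ, g (r + y) :=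
    funext (windowIntegral_eq g τ)
  rw [this]
  exact intervalIntegral.continuous_parametric_intervalIntegral_of_continuous'
    (f := fun r y => g (r + y)) (by fun_prop) _ _

lemma windowIntegral_neg (hodd : ∀ r, g (-r) = -g r) (τ r : ℝ) :
    windowIntegral g τ (-r) = -windowIntegral g τ r := by
  have h := intervalIntegral.integral_comp_neg (f := g) (a := -r - τ) (b := -r + τ)
  simp only [hodd, intervalIntegral.integral_neg] at h
  rw [windowIntegral, windowIntegral, show r - τ = -(-r + τ) by ring,
    show r + τ = -(-r - τ) by ring, ← h, neg_neg]

/-- Both weights survive a shift by |y| ≤ τ, and the window has length 2τ. The extra 1 + |r| is what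
makes the window integral divided by r integrable on ℝ³. -/
lemma abs_windowIntegral_le (hC : 0 ≤ C) (hb : ∀ r, (1 + |r|) * |g r| ≤ C / (1 + r ^ 2)) {τ : ℝ}
    (hτ : 0 ≤ τ) (r : ℝ) :
    (1 + |r|) * |windowIntegral g τ r| ≤
      (1 + τ) * (C * (2 + 2 * τ ^ 2)) * (2 * τ) / (1 + r ^ 2) := by
  rw [windowIntegral_eq, ← Real.norm_eq_abs (intervalIntegral _ _ _ _)]
  have h : ∀ y ∈ Set.uIoc (-τ) τ, ‖g (r + y)‖ ≤
      (1 + τ) * (C * (2 + 2 * τ ^ 2)) / (1 + r ^ 2) / (1 + |r|) := by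
    intro y hy
    rw [Set.uIoc_of_le (by linarith)] at hy
    have hy : |y| ≤ τ := abs_le.2 ⟨hy.1.le, hy.2⟩
    rw [le_div_iff₀ (by positivity), Real.norm_eq_abs]
    have h1 : 1 + |r| ≤ (1 + τ) * (1 + |r + y|) := by
      have h2 : |r| ≤ |r + y| + |y| := by
        have := abs_sub (r + y) y
        simpa using this
      nlinarith [abs_nonneg (r + y)]
    calc |g (r + y)| * (1 + |r|) ≤ |g (r + y)| * ((1 + τ) * (1 + |r + y|)) := by gcongr
      _ = (1 + τ) * ((1 + |r + y|) * |g (r + y)|) := by ring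
      _ ≤ (1 + τ) * (C * (2 + 2 * τ ^ 2) / (1 + r ^ 2)) := by
          gcongr
          exact (hb _).trans (div_one_add_sq_le_of_abs_le hC hy)
      _ = _ := by ring
  have := intervalIntegral.norm_integral_le_of_norm_le_const h
  rw [show τ - -τ = 2 * τ by ring, abs_of_nonneg (by linarith : 0 ≤ 2 * τ)] at this
  calc _ ≤ (1 + |r|) * ((1 + τ) * (C * (2 + 2 * τ ^ 2)) / (1 + r ^ 2) / (1 + |r|) * (2 * τ)) := by
        gcongr
    _ = _ := by
        have : 0 < 1 + |r| := by positivity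
        field_simp

lemma integrable_of_one_add_abs_mul_le (hg : Continuous g)
    (hb : ∀ r, (1 + |r|) * |g r| ≤ C / (1 + r ^ 2)) : Integrable g := by
  refine (integrable_const_div_one_add_sq C).mono' hg.aestronglyMeasurable
    (Filter.Eventually.of_forall fun r => ?_)
  rw [Real.norm_eq_abs]
  exact (le_mul_of_one_le_left (abs_nonneg _) (by linarith [abs_nonneg r])).trans (hb r)

/-- The window is convolution with the indicator of [-τ, τ], whose transform is 2 sin(κτ)/κ. -/
lemma integral_windowIntegral_mul_sin (hC : 0 ≤ C) (hg : Continuous g)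
    (hb : ∀ r, (1 + |r|) * |g r| ≤ C / (1 + r ^ 2)) {τ : ℝ} (hτ : 0 ≤ τ) {κ : ℝ} (hκ : κ ≠ 0) :
    ∫ r, windowIntegral g τ r * Real.sin (κ * r) =
      2 * Real.sin (κ * τ) / κ * ∫ ρ, g ρ * Real.sin (κ * ρ) := by
  have hgi := integrable_of_one_add_abs_mul_le hg hb
  have hgs : Integrable fun ρ => g ρ * Real.sin (κ * ρ) :=
    hgi.mul_bdd (c := 1) (by fun_prop) (Filter.Eventually.of_forall fun ρ => Real.abs_sin_le_one _)
  have hgc : Integrable fun ρ => g ρ * Real.cos (κ * ρ) :=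
    hgi.mul_bdd (c := 1) (by fun_prop) (Filter.Eventually.of_forall fun ρ => Real.abs_cos_le_one _)
  have h1 : ∀ r, windowIntegral g τ r * Real.sin (κ * r) =
      ∫ y in Set.Ioc (-τ) τ, g (r + y) * Real.sin (κ * r) := by
    intro r
    rw [windowIntegral_eq, intervalIntegral.integral_of_le (by linarith), integral_mul_const]
  simp only [h1]
  rw [integral_integral_swap]
  · have h2 : ∀ y, ∫ r, g (r + y) * Real.sin (κ * r) =
        Real.cos (κ * y) * (∫ ρ, g ρ * Real.sin (κ * ρ)) -
          Real.sin (κ * y) * ∫ ρ, g ρ * Real.cos (κ * ρ) := by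
      intro y
      rw [← integral_const_mul, ← integral_const_mul, ← integral_sub (hgs.const_mul _)
        (hgc.const_mul _), ← integral_sub_right_eq_self _ y]
      refine integral_congr_ae (Filter.Eventually.of_forall fun ρ => ?_)
      simp only [sub_add_cancel, mul_sub, Real.sin_sub]
      ring
    simp only [h2]
    -- Over the symmetric interval the sin(κy) term integrates to zero, so no parity of g is needed.
    rw [← intervalIntegral.integral_of_le (by linarith), intervalIntegral.integral_sub
      (Continuous.intervalIntegrable (by fun_prop) _ _) (Continuous.intervalIntegrable (by fun_prop) _ _),
      intervalIntegral.integral_mul_const, intervalIntegral.integral_mul_const,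
      intervalIntegral.integral_comp_mul_left _ hκ, intervalIntegral.integral_comp_mul_left _ hκ,
      integral_cos, integral_sin]
    simp only [mul_neg, Real.sin_neg, Real.cos_neg, smul_eq_mul]
    field_simp
    ring
  · have : Integrable (fun z : ℝ × ℝ => C * (2 + 2 * τ ^ 2) / (1 + z.1 ^ 2) * 1)
        ((volume : Measure ℝ).prod (volume.restrict (Set.Ioc (-τ) τ))) :=
      (integrable_const_div_one_add_sq _).mul_prod (integrable_const (1 : ℝ))
    refine this.mono' (by unfold Function.uncurry; fun_prop) ?_
    have hy : ∀ᵐ z : ℝ × ℝ ∂((volume : Measure ℝ).prod (volume.restrict (Set.Ioc (-τ) τ))),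
        z.2 ∈ Set.Ioc (-τ) τ :=
      Measure.quasiMeasurePreserving_snd.ae (ae_restrict_mem measurableSet_Ioc)
    filter_upwards [hy] with z hz
    simp only [Function.uncurry, mul_one, norm_mul, Real.norm_eq_abs]
    have h3 : |g (z.1 + z.2)| ≤ C / (1 + (z.1 + z.2) ^ 2) :=
      (le_mul_of_one_le_left (abs_nonneg _) (by linarith [abs_nonneg (z.1 + z.2)])).trans (hb _)
    exact (mul_le_of_le_one_right (abs_nonneg _) (Real.abs_sin_le_one _)).trans
      (h3.trans (div_one_add_sq_le_of_abs_le hC (abs_le.2 ⟨hz.1.le, hz.2⟩)))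

end Window

lemma integral_Ioi_eq_half_of_even {f : ℝ → ℝ} (h : ∀ r, f (-r) = f r) :
    ∫ r in Set.Ioi (0 : ℝ), f r = (∫ r, f r) / 2 := by
  have h1 := integral_comp_abs (f := f)
  have h2 : ∀ r, f |r| = f r := fun r => by
    rcases abs_choice r with hr | hr <;> rw [hr]
    exact h r
  simp only [h2] at h1
  linarith

lemma integrable_radial_of_mul_le {F : ℝ → ℝ} (hF : Measurable F) {C : ℝ}
    (hb : ∀ r, 0 < r → r ^ 2 * |F r| ≤ C / (1 + r ^ 2)) :
    Integrable fun x : Space => (F ‖x‖ : ℂ) := by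
  rw [integrable_radial_iff (F := fun r => (F r : ℂ)) (by fun_prop)]
  refine Integrable.mono' (g := fun r => 4 * Real.pi * (C / (1 + r ^ 2)))
    ((integrable_const_div_one_add_sq C).const_mul _).integrableOn ?_ ?_
  · exact ((by fun_prop : Measurable fun r : ℝ => 4 * Real.pi * r ^ 2).smul
      (by fun_prop : Measurable fun r : ℝ => (F r : ℂ))).aestronglyMeasurable
  · refine (ae_restrict_iff' measurableSet_Ioi).2 (Filter.Eventually.of_forall fun r hr => ?_)
    rw [norm_smul, Real.norm_of_nonneg (by positivity), Complex.norm_real, Real.norm_eq_abs]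
    have := hb r hr
    have hpi := Real.pi_pos
    nlinarith

section Kirchhoff

variable {F : ℝ → ℝ} {C : ℝ}

lemma measurable_inv_mul_windowIntegral {g : ℝ → ℝ} (hg : Continuous g) (τ : ℝ) :
    Measurable fun r => 1 / (2 * r) * windowIntegral g τ r :=
  (by fun_prop : Measurable fun r : ℝ => 1 / (2 * r)).mul (continuous_windowIntegral hg τ).measurable

lemma one_add_abs_mul_le (hb : ∀ r, |F r| ≤ C / (1 + r ^ 2) ^ 2) (r : ℝ) :
    (1 + |r|) * |r * F r| ≤ 2 * C / (1 + r ^ 2) := by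
  have hC : 0 ≤ C := by
    have := (abs_nonneg _).trans (hb 0)
    simpa using this
  rw [abs_mul]
  have h1 : (1 + |r|) * |r| ≤ 2 * (1 + r ^ 2) := by
    nlinarith [sq_abs r, sq_nonneg (|r| - 1)]
  calc (1 + |r|) * (|r| * |F r|) = ((1 + |r|) * |r|) * |F r| := by ring
    _ ≤ (2 * (1 + r ^ 2)) * (C / (1 + r ^ 2) ^ 2) := by
        gcongr
        exact hb r
    _ = _ := by field_simp

lemma integrable_radial_inv_mul_windowIntegral {g : ℝ → ℝ} (hC : 0 ≤ C) (hg : Continuous g)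
    (hb : ∀ r, (1 + |r|) * |g r| ≤ C / (1 + r ^ 2)) {τ : ℝ} (hτ : 0 ≤ τ) :
    Integrable fun x : Space => ((1 / (2 * ‖x‖) * windowIntegral g τ ‖x‖ : ℝ) : ℂ) := by
  refine integrable_radial_of_mul_le (measurable_inv_mul_windowIntegral hg τ)
    (C := (1 + τ) * (C * (2 + 2 * τ ^ 2)) * (2 * τ)) fun r hr => ?_
  refine le_trans ?_ (abs_windowIntegral_le hC hb hτ r)
  rw [abs_mul, abs_of_pos (by positivity : 0 < 1 / (2 * r)), abs_of_pos hr]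
  have : r ^ 2 * (1 / (2 * r) * |windowIntegral g τ r|) = r / 2 * |windowIntegral g τ r| := by
    field_simp
  rw [this]
  gcongr
  linarith

/-- Kirchhoff's formula for radial functions, in its weak form. -/
lemma integral_mul_sinPropagator (hF : Continuous F) (heven : ∀ r, F (-r) = F r)
    (hb : ∀ r, |F r| ≤ C / (1 + r ^ 2) ^ 2) {τ : ℝ} (hτ : 0 ≤ τ) (φ : 𝓢(Space, ℂ)) :
    ∫ x : Space, (F ‖x‖ : ℂ) * sinPropagator τ φ x =
      ∫ x : Space, ((1 / (2 * ‖x‖) * windowIntegral (fun ρ => ρ * F ρ) τ ‖x‖ : ℝ) : ℂ) * φ x := by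
  have hC : 0 ≤ C := by
    have := (abs_nonneg _).trans (hb 0)
    simpa using this
  have hC2 : 0 ≤ 2 * C := by positivity
  set g : ℝ → ℝ := fun ρ => ρ * F ρ with hgdef
  have hg : Continuous g := by fun_prop
  have hgb : ∀ r, (1 + |r|) * |g r| ≤ 2 * C / (1 + r ^ 2) := one_add_abs_mul_le hb
  have hodd : ∀ r, g (-r) = -g r := fun r => by simp [hgdef, heven]
  have hFi : Integrable fun x : Space => (F ‖x‖ : ℂ) := by
    refine integrable_radial_of_mul_le hF.measurable (C := C) fun r hr => ?_
    calc r ^ 2 * |F r| ≤ (1 + r ^ 2) * (C / (1 + r ^ 2) ^ 2) := by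
          gcongr
          · linarith
          · exact hb r
      _ = _ := by field_simp
  have hHi := integrable_radial_inv_mul_windowIntegral hC2 hg hgb hτ
  -- In sine transforms the window contributes 2 sin(κτ)/κ with κ = 2π|ξ|; the prefactor 1/(2r)
  -- turns this into sin(κτ)/κ, the multiplier of the propagator.
  have hFour : ∀ ξ : Space, ξ ≠ 0 →
      𝓕 (fun x : Space => ((1 / (2 * ‖x‖) * windowIntegral g τ ‖x‖ : ℝ) : ℂ)) ξ =
        ((τ * Real.sinc (τ * (2 * Real.pi * ‖ξ‖)) : ℝ) : ℂ) * 𝓕 (fun x : Space => (F ‖x‖ : ℂ)) ξ := by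
    intro ξ hξ
    have hm1 : Measurable fun r : ℝ => ((1 / (2 * r) * windowIntegral g τ r : ℝ) : ℂ) :=
      Complex.measurable_ofReal.comp (measurable_inv_mul_windowIntegral hg τ)
    have hm2 : Measurable fun r : ℝ => (F r : ℂ) := by fun_prop
    rw [fourier_radial hm1 hHi hξ, fourier_radial hm2 hFi hξ]
    have hk : 0 < ‖ξ‖ := norm_pos_iff.2 hξ
    set k := ‖ξ‖
    have hpi := Real.pi_pos
    have hκ : 2 * Real.pi * k ≠ 0 := by positivity
    have e1 : ∫ r in Set.Ioi (0 : ℝ), ((r * Real.sin (2 * Real.pi * k * r) : ℝ) : ℂ) *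
        ((1 / (2 * r) * windowIntegral g τ r : ℝ) : ℂ) =
        ((∫ r in Set.Ioi (0 : ℝ), (windowIntegral g τ r * Real.sin (2 * Real.pi * k * r)) / 2 : ℝ) : ℂ) := by
      rw [← integral_complex_ofReal]
      refine setIntegral_congr_fun measurableSet_Ioi fun r hr => ?_
      have hr : 0 < r := hr
      rw [← Complex.ofReal_mul]
      congr 1
      field_simp
    have e2 : ∫ r in Set.Ioi (0 : ℝ), ((r * Real.sin (2 * Real.pi * k * r) : ℝ) : ℂ) * (F r : ℂ) =
        ((∫ r in Set.Ioi (0 : ℝ), g r * Real.sin (2 * Real.pi * k * r) : ℝ) : ℂ) := by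
      rw [← integral_complex_ofReal]
      refine setIntegral_congr_fun measurableSet_Ioi fun r hr => ?_
      rw [← Complex.ofReal_mul]
      congr 1
      simp only [hgdef]
      ring
    rw [e1, e2, integral_div, integral_Ioi_eq_half_of_even
      (f := fun r => windowIntegral g τ r * Real.sin (2 * Real.pi * k * r)),
      integral_Ioi_eq_half_of_even (f := fun r => g r * Real.sin (2 * Real.pi * k * r)),
      integral_windowIntegral_mul_sin hC2 hg hgb hτ hκ, ← Complex.ofReal_mul, ← Complex.ofReal_mul,
      ← Complex.ofReal_mul]
    · congr 1
      have hsinc : Real.sin (2 * Real.pi * k * τ) =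
          τ * Real.sinc (τ * (2 * Real.pi * k)) * (2 * Real.pi * k) := by
        rcases hτ.eq_or_lt with h0 | h0
        · simp [← h0]
        · rw [Real.sinc_of_ne_zero (by positivity)]
          field_simp
      rw [hsinc]
      field_simp
    · intro r
      rw [hodd, mul_neg, Real.sin_neg]
      ring
    · intro r
      rw [windowIntegral_neg hodd, mul_neg, Real.sin_neg]
      ring
  have hφ1 : Integrable fun ξ : Space => 𝓕 (φ : Space → ℂ) (-ξ) := by
    have := (𝓕 φ).integrable (μ := volume)
    rw [SchwartzMap.fourier_coe] at this
    exact this.comp_neg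
  have hψ1 : Integrable fun ξ : Space =>
      ((τ * Real.sinc (τ * (2 * Real.pi * ‖ξ‖)) : ℝ) : ℂ) * 𝓕 (φ : Space → ℂ) (-ξ) := by
    refine hφ1.bdd_mul (c := |τ|) ?_ (Filter.Eventually.of_forall fun ξ => ?_)
    · exact (by fun_prop : Measurable fun ξ : Space =>
        ((τ * Real.sinc (τ * (2 * Real.pi * ‖ξ‖)) : ℝ) : ℂ)).aestronglyMeasurable
    · rw [Complex.norm_real]
      exact abs_mul_sinc_le _ _
  have hinv : sinPropagator τ φ = 𝓕 (fun ξ : Space =>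
      ((τ * Real.sinc (τ * (2 * Real.pi * ‖ξ‖)) : ℝ) : ℂ) * 𝓕 (φ : Space → ℂ) (-ξ)) := by
    ext x
    rw [sinPropagator, Real.fourierInv_eq_fourier_comp_neg]
    simp only [norm_neg]
  have hφinv : 𝓕 (fun ξ : Space => 𝓕 (φ : Space → ℂ) (-ξ)) = φ := by
    ext x
    rw [← Real.fourierInv_eq_fourier_comp_neg, ← SchwartzMap.fourier_coe, ← SchwartzMap.fourierInv_coe]
    simp
  -- Unlike the linear data, F and its window average are integrable on ℝ³, so the multiplication
  -- formula replaces Plancherel.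
  rw [hinv, ← integral_fourier_mul_eq hFi hψ1]
  conv_rhs => rw [← hφinv, ← integral_fourier_mul_eq hHi hφ1]
  refine integral_congr_ae ?_
  filter_upwards [ae_ne_zero] with ξ hξ
  rw [hFour ξ hξ]
  ring

end Kirchhoff

/-! ### Compactified null coordinates and their change of variables. -/

/-- Compactified null coordinates `(t, r) ↦ (arctan (t + r), arctan (t - r))`. -/
noncomputable def nullMap (z : ℝ × ℝ) : ℝ × ℝ := (Real.arctan (z.1 + z.2), Real.arctan (z.1 - z.2))

/-- The Jacobian of `nullMap`. -/
noncomputable def nullDensity (z : ℝ × ℝ) : ℝ := 2 / ((1 + (z.1 + z.2) ^ 2) * (1 + (z.1 - z.2) ^ 2))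

/-- The range of `nullMap`. -/
def nullSquare : Set (ℝ × ℝ) :=
  Set.Ioo (-(Real.pi / 2)) (Real.pi / 2) ×ˢ Set.Ioo (-(Real.pi / 2)) (Real.pi / 2)

@[fun_prop]
lemma continuous_nullMap : Continuous nullMap := by
  unfold nullMap
  fun_prop

lemma nullDensity_pos (z : ℝ × ℝ) : 0 < nullDensity z := by
  unfold nullDensity
  positivity

@[fun_prop]
lemma continuous_nullDensity : Continuous nullDensity := by
  unfold nullDensity
  refine continuous_const.div (by fun_prop) fun z => ?_
  positivity

lemma lintegral_comp_arctan (G : ℝ → ENNReal) :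
    ∫⁻ p : ℝ, ENNReal.ofReal (1 / (1 + p ^ 2)) * G (Real.arctan p) =
      ∫⁻ a in Set.Ioo (-(Real.pi / 2)) (Real.pi / 2), G a := by
  have h := lintegral_image_eq_lintegral_abs_deriv_mul (s := Set.univ) (f := Real.arctan)
    (f' := fun p => 1 / (1 + p ^ 2)) MeasurableSet.univ
    (fun x _ => (Real.hasDerivAt_arctan x).hasDerivWithinAt) Real.arctan_injective.injOn G
  rw [Set.image_univ, Real.range_arctan, Measure.restrict_univ] at h
  rw [h]
  refine lintegral_congr fun p => ?_
  rw [abs_of_pos (by positivity)]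

lemma lintegral_comp_arctan_sub_two_mul (p : ℝ) (G : ℝ → ENNReal) :
    ∫⁻ r : ℝ, ENNReal.ofReal (2 / (1 + (p - 2 * r) ^ 2)) * G (Real.arctan (p - 2 * r)) =
      ∫⁻ b in Set.Ioo (-(Real.pi / 2)) (Real.pi / 2), G b := by
  have himg : (fun r => Real.arctan (p - 2 * r)) '' Set.univ =
      Set.Ioo (-(Real.pi / 2)) (Real.pi / 2) := by
    rw [← Real.range_arctan, Set.image_univ]
    ext b
    constructor
    · rintro ⟨r, rfl⟩
      exact ⟨_, rfl⟩
    · rintro ⟨q, rfl⟩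
      exact ⟨(p - q) / 2, by simp only; congr 1; ring⟩
  have h := lintegral_image_eq_lintegral_abs_deriv_mul (s := Set.univ)
    (f := fun r => Real.arctan (p - 2 * r))
    (f' := fun r => 1 / (1 + (p - 2 * r) ^ 2) * (-(2 * 1))) MeasurableSet.univ
    (fun x _ => (((hasDerivAt_id x).const_mul 2).const_sub p).arctan.hasDerivWithinAt)
    (fun x _ y _ hxy => by
      have := Real.arctan_injective hxy
      linarith) G
  rw [himg, Measure.restrict_univ] at h
  rw [h]
  refine lintegral_congr fun r => ?_
  congr 2
  rw [abs_of_nonpos (by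
    have : 0 < 1 / (1 + (p - 2 * r) ^ 2) := by positivity
    linarith)]
  ring

/-- Only one-variable substitutions are used: at fixed r set p = t + r, then at fixed p let r vary
in t - r = p - 2r, whose factor 2 is the 2 in the Jacobian. -/
lemma lintegral_nullMap {K : ℝ × ℝ → ENNReal} (hK : Measurable K) :
    ∫⁻ z, ENNReal.ofReal (nullDensity z) * K (nullMap z) = ∫⁻ z in nullSquare, K z := by
  rw [nullSquare, Measure.volume_eq_prod, setLIntegral_prod _ hK.aemeasurable,
    ← lintegral_comp_arctan, lintegral_prod_symm _ (by fun_prop)]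
  have h1 : ∀ r : ℝ, ∫⁻ t, ENNReal.ofReal (nullDensity (t, r)) * K (nullMap (t, r)) =
      ∫⁻ p, ENNReal.ofReal (1 / (1 + p ^ 2)) * (ENNReal.ofReal (2 / (1 + (p - 2 * r) ^ 2)) *
        K (Real.arctan p, Real.arctan (p - 2 * r))) := by
    intro r
    rw [← lintegral_add_right_eq_self (fun p => ENNReal.ofReal (1 / (1 + p ^ 2)) * _) r]
    refine lintegral_congr fun t => ?_
    rw [← mul_assoc, ← ENNReal.ofReal_mul (by positivity), nullMap, nullDensity,
      show t + r - 2 * r = t - r by ring]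
    congr 2
    field_simp
  simp only [h1]
  rw [lintegral_lintegral_swap (by unfold Function.uncurry; fun_prop)]
  refine lintegral_congr fun p => ?_
  rw [lintegral_const_mul _ (by fun_prop)]
  congr 1
  exact lintegral_comp_arctan_sub_two_mul p fun b => K (Real.arctan p, b)

lemma measurePreserving_nullMap :
    MeasurePreserving nullMap (volume.withDensity fun z => ENNReal.ofReal (nullDensity z))
      (volume.restrict nullSquare) := by
  refine ⟨continuous_nullMap.measurable, Measure.ext fun s hs => ?_⟩
  rw [Measure.map_apply continuous_nullMap.measurable hs, ← lintegral_indicator_one hs,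
    ← lintegral_indicator_one (continuous_nullMap.measurable hs),
    lintegral_withDensity_eq_lintegral_mul _ (by fun_prop)
    (measurable_one.indicator (continuous_nullMap.measurable hs)),
    ← lintegral_nullMap (measurable_one.indicator hs)]
  rfl

lemma integrable_nullMap_iff {K : ℝ × ℝ → ℝ} (hK : Measurable K) :
    (Integrable fun z => nullDensity z * K (nullMap z)) ↔ IntegrableOn K nullSquare := by
  rw [IntegrableOn, ← measurePreserving_nullMap.integrable_comp hK.aestronglyMeasurable,
    integrable_withDensity_iff_integrable_smul' (by fun_prop) (by simp)]
  simp only [ENNReal.toReal_ofReal (nullDensity_pos _).le, smul_eq_mul, Function.comp]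

lemma integral_nullMap {K : ℝ × ℝ → ℝ} (hK : Measurable K) :
    ∫ z, nullDensity z * K (nullMap z) = ∫ z in nullSquare, K z := by
  rw [← measurePreserving_nullMap.map_eq, integral_map continuous_nullMap.measurable.aemeasurable
    hK.aestronglyMeasurable, integral_withDensity_eq_integral_toReal_smul (by fun_prop) (by simp)]
  simp only [ENNReal.toReal_ofReal (nullDensity_pos _).le, smul_eq_mul]

/-! ### The cubic source and its light-cone integral in null coordinates. -/

/-- The source `cos³ (T - θ)` times `sin R`, in null coordinates `a = (T + R) / 2`, `b = (T - R) / 2`. -/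
noncomputable def nullSource (θ a b : ℝ) : ℝ := Real.sin (a - b) * Real.cos (a + b - θ) ^ 3

lemma abs_nullSource_le (θ a b : ℝ) : |nullSource θ a b| ≤ 1 := by
  rw [nullSource, abs_mul, abs_pow]
  exact mul_le_one₀ (Real.abs_sin_le_one _) (by positivity)
    (pow_le_one₀ (abs_nonneg _) (Real.abs_cos_le_one _))

@[fun_prop]
lemma continuous_radialConformalFactor : Continuous fun z : ℝ × ℝ => radialConformalFactor z.1 z.2 := by
  unfold radialConformalFactor
  refine continuous_const.div (by fun_prop) fun z => ?_
  positivity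

@[fun_prop]
lemma continuous_waveProfile (θ : ℝ) : Continuous fun z : ℝ × ℝ => waveProfile θ z.1 z.2 := by
  unfold waveProfile
  fun_prop

lemma radialConformalFactor_pos (t r : ℝ) : 0 < radialConformalFactor t r := by
  unfold radialConformalFactor
  positivity

lemma radialConformalFactor_sq (t r : ℝ) :
    radialConformalFactor t r ^ 2 = 2 * nullDensity (t, r) := by
  rw [radialConformalFactor, nullDensity, div_pow, mul_pow, Real.sq_sqrt (by positivity),
    Real.sq_sqrt (by positivity)]
  ring

lemma mul_radialConformalFactor (t r : ℝ) :
    r * radialConformalFactor t r = Real.sin (Real.arctan (t + r) - Real.arctan (t - r)) := by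
  rw [radialConformalFactor, Real.sin_sub, Real.cos_arctan, Real.cos_arctan, Real.sin_arctan,
    Real.sin_arctan]
  have p1 : 0 < √(1 + (t + r) ^ 2) := Real.sqrt_pos.2 (by positivity)
  have p2 : 0 < √(1 + (t - r) ^ 2) := Real.sqrt_pos.2 (by positivity)
  field_simp
  ring

/-- Of the three factors Ω, one combines with r into sin R and the other two give twice the
Jacobian. -/
lemma mul_waveProfile_cube (θ t r : ℝ) : r * waveProfile θ t r ^ 3 =
    nullDensity (t, r) * (2 * nullSource θ (nullMap (t, r)).1 (nullMap (t, r)).2) := by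
  have h1 := mul_radialConformalFactor t r
  have h2 := radialConformalFactor_sq t r
  rw [waveProfile, nullSource, nullMap]
  simp only
  rw [← h1]
  linear_combination (r * radialConformalFactor t r *
    Real.cos (Real.arctan (t + r) + Real.arctan (t - r) - θ) ^ 3) * h2

lemma radialConformalFactor_le (t r : ℝ) :
    radialConformalFactor t r ≤ 2 * (1 + t ^ 2) / (1 + r ^ 2) := by
  rw [radialConformalFactor, div_le_div_iff₀ (by positivity) (by positivity), mul_assoc]
  refine mul_le_mul_of_nonneg_left ?_ two_pos.le
  rw [← Real.sqrt_mul (by positivity)]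
  have h1 : 1 ≤ √((1 + (t + r) ^ 2) * (1 + (t - r) ^ 2)) := by
    rw [Real.one_le_sqrt]
    nlinarith [sq_nonneg (t + r), sq_nonneg (t - r), mul_nonneg (sq_nonneg (t + r)) (sq_nonneg (t - r))]
  -- With p = t + r and q = t - r, (1 + p²)(1 + q²) = (1 - pq)² + (p + q)². Adding t² times `h1` to
  -- this bound gives 1 + r².
  have h2 : 1 - (t + r) * (t - r) ≤ √((1 + (t + r) ^ 2) * (1 + (t - r) ^ 2)) := by
    apply Real.le_sqrt_of_sq_le
    nlinarith [sq_nonneg ((t + r) + (t - r))]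
  nlinarith [mul_le_mul_of_nonneg_left h1 (sq_nonneg t)]

lemma abs_waveProfile_le (θ t r : ℝ) : |waveProfile θ t r| ≤ radialConformalFactor t r := by
  rw [waveProfile, abs_mul, abs_of_pos (radialConformalFactor_pos t r)]
  exact mul_le_of_le_one_right (radialConformalFactor_pos t r).le (Real.abs_cos_le_one _)

lemma radialConformalFactor_neg (t r : ℝ) :
    radialConformalFactor t (-r) = radialConformalFactor t r := by
  rw [radialConformalFactor, radialConformalFactor, ← sub_eq_add_neg, sub_neg_eq_add, mul_comm (√_)]

lemma waveProfile_neg (θ t r : ℝ) : waveProfile θ t (-r) = waveProfile θ t r := by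
  rw [waveProfile, waveProfile, radialConformalFactor_neg, ← sub_eq_add_neg, sub_neg_eq_add,
    add_comm (Real.arctan _)]

lemma abs_waveProfile_cube_le (θ t r : ℝ) :
    |waveProfile θ t r ^ 3| ≤ (2 * (1 + t ^ 2)) ^ 3 / (1 + r ^ 2) ^ 2 := by
  rw [abs_pow]
  calc |waveProfile θ t r| ^ 3 ≤ (2 * (1 + t ^ 2) / (1 + r ^ 2)) ^ 3 :=
        pow_le_pow_left₀ (abs_nonneg _) ((abs_waveProfile_le θ t r).trans
          (radialConformalFactor_le t r)) 3
    _ = (2 * (1 + t ^ 2)) ^ 3 / (1 + r ^ 2) ^ 2 * (1 / (1 + r ^ 2)) := by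
        rw [div_pow]
        field_simp
    _ ≤ _ := by
        refine mul_le_of_le_one_right (by positivity) ?_
        rw [div_le_one (by positivity)]
        nlinarith [sq_nonneg r]

/-- The retarded solution times `sin R` in null coordinates. -/
noncomputable def nullPotential (θ A B : ℝ) : ℝ :=
  ∫ a in (-(Real.pi / 2))..A, ∫ b in (-(Real.pi / 2))..B, nullSource θ a b

lemma volume_nullSquare_lt_top : volume nullSquare < ⊤ := by
  rw [nullSquare, Measure.volume_eq_prod, Measure.prod_prod, Real.volume_Ioo]
  exact ENNReal.mul_lt_top ENNReal.ofReal_lt_top ENNReal.ofReal_lt_top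

lemma measurable_nullSource (θ : ℝ) : Measurable fun z : ℝ × ℝ => nullSource θ z.1 z.2 := by
  unfold nullSource
  fun_prop

lemma integrableOn_nullSource (θ : ℝ) : IntegrableOn (fun z => nullSource θ z.1 z.2) nullSquare :=
  Measure.integrableOn_of_bounded volume_nullSquare_lt_top.ne
    (measurable_nullSource θ).aestronglyMeasurable (M := 1)
    (Filter.Eventually.of_forall fun _ => abs_nullSource_le _ _ _)

/-- In null coordinates this is a bounded function on a square of finite area. It supplies the
domination for Duhamel's integral down to s = -∞. -/
lemma integrable_mul_waveProfile_cube (θ : ℝ) :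
    Integrable fun z : ℝ × ℝ => z.2 * waveProfile θ z.1 z.2 ^ 3 := by
  have h := (integrable_nullMap_iff (K := fun z => 2 * nullSource θ z.1 z.2)
    ((measurable_nullSource θ).const_mul 2)).2 ((integrableOn_nullSource θ).const_mul 2)
  exact h.congr (Filter.Eventually.of_forall fun z => (mul_waveProfile_cube θ z.1 z.2).symm)

/-- The integral of the source over the backward light cone, in null coordinates. -/
lemma integral_windowIntegral_waveProfile_cube (θ t r : ℝ) :
    ∫ s in Set.Iio t, windowIntegral (fun ρ => ρ * waveProfile θ s ρ ^ 3) (t - s) r =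
      2 * nullPotential θ (Real.arctan (t + r)) (Real.arctan (t - r)) := by
  set A := Real.arctan (t + r)
  set B := Real.arctan (t - r)
  -- One inequality is strict so that each time slice is exactly a half-open window, empty for s ≥
  -- t.
  set E : Set (ℝ × ℝ) := {z | z.1 ≤ A ∧ z.2 < B} with hE
  have hEm : MeasurableSet E :=
    (measurableSet_le measurable_fst measurable_const).inter
      (measurableSet_lt measurable_snd measurable_const)
  set K : ℝ × ℝ → ℝ := E.indicator fun z => 2 * nullSource θ z.1 z.2 with hKdef
  have hK : Measurable K := ((measurable_nullSource θ).const_mul 2).indicator hEm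
  have hKi : IntegrableOn K nullSquare := ((integrableOn_nullSource θ).const_mul 2).indicator hEm
  have hi := (integrable_nullMap_iff hK).2 hKi
  have h1 := integral_nullMap hK
  rw [Measure.volume_eq_prod] at hi
  rw [Measure.volume_eq_prod, integral_prod _ hi] at h1
  have h2 : ∀ s, ∫ ρ, nullDensity (s, ρ) * K (nullMap (s, ρ)) = (Set.Iio t).indicator
      (fun s => windowIntegral (fun ρ => ρ * waveProfile θ s ρ ^ 3) (t - s) r) s := by
    intro s
    have h3 : ∀ ρ, nullDensity (s, ρ) * K (nullMap (s, ρ)) =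
        (Set.Ioc (r - (t - s)) (r + (t - s))).indicator (fun ρ => ρ * waveProfile θ s ρ ^ 3) ρ := by
      intro ρ
      have h4 : nullMap (s, ρ) ∈ E ↔ ρ ∈ Set.Ioc (r - (t - s)) (r + (t - s)) := by
        simp only [hE, Set.mem_ofPred_eq, nullMap, A, B, Real.arctan_le_arctan_iff,
          Real.arctan_lt_arctan_iff, Set.mem_Ioc]
        constructor
        · rintro ⟨h, h'⟩; constructor <;> linarith
        · rintro ⟨h, h'⟩; constructor <;> linarith
      by_cases h : nullMap (s, ρ) ∈ E
      · rw [hKdef, Set.indicator_of_mem h, Set.indicator_of_mem (h4.1 h), mul_waveProfile_cube]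
      · rw [hKdef, Set.indicator_of_notMem h, Set.indicator_of_notMem (fun h' => h (h4.2 h')), mul_zero]
    simp only [h3]
    rw [integral_indicator measurableSet_Ioc]
    by_cases hs : s < t
    · rw [Set.indicator_of_mem (Set.mem_Iio.2 hs), windowIntegral,
        intervalIntegral.integral_of_le (by linarith)]
    · rw [Set.indicator_of_notMem (by simpa using hs), Set.Ioc_eq_empty (by linarith)]
      simp
  simp only [h2] at h1
  rw [integral_indicator measurableSet_Iio] at h1
  rw [h1, hKdef, setIntegral_indicator hEm, integral_const_mul, nullPotential]
  congr 1
  have hA : -(Real.pi / 2) ≤ A ∧ A < Real.pi / 2 :=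
    ⟨(Real.neg_pi_div_two_lt_arctan _).le, Real.arctan_lt_pi_div_two _⟩
  have hB : -(Real.pi / 2) ≤ B ∧ B < Real.pi / 2 :=
    ⟨(Real.neg_pi_div_two_lt_arctan _).le, Real.arctan_lt_pi_div_two _⟩
  have h5 : nullSquare ∩ E = Set.Ioc (-(Real.pi / 2)) A ×ˢ Set.Ioo (-(Real.pi / 2)) B := by
    ext z
    simp only [nullSquare, hE, Set.mem_inter_iff, Set.mem_prod, Set.mem_Ioo, Set.mem_Ioc,
      Set.mem_ofPred_eq]
    constructor
    · rintro ⟨⟨⟨h1, h2⟩, h3, h4⟩, h5, h6⟩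
      exact ⟨⟨h1, h5⟩, h3, h6⟩
    · rintro ⟨⟨h1, h2⟩, h3, h4⟩
      exact ⟨⟨⟨h1, h2.trans_lt hA.2⟩, h3, h4.trans hB.2⟩, h2, h4⟩
  have h6 : IntegrableOn (fun z : ℝ × ℝ => nullSource θ z.1 z.2)
      (Set.Ioc (-(Real.pi / 2)) A ×ˢ Set.Ioo (-(Real.pi / 2)) B) :=
    h5 ▸ (integrableOn_nullSource θ).mono_set Set.inter_subset_left
  rw [← Measure.volume_eq_prod, h5, Measure.volume_eq_prod, setIntegral_prod _ h6,
    intervalIntegral.integral_of_le hA.1]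
  refine setIntegral_congr_fun measurableSet_Ioc fun a _ => ?_
  simp only
  rw [intervalIntegral.integral_of_le hB.1, integral_Ioc_eq_integral_Ioo]

/-! ### Duhamel's formula in weak form. -/

lemma exists_norm_schwartz_le (φ : 𝓢(Space, ℂ)) :
    ∃ C, 0 ≤ C ∧ ∀ x, ‖φ x‖ ≤ C / (1 + ‖x‖ ^ 2) ^ 2 := by
  obtain ⟨C0, h0⟩ := φ.decay 0 0
  obtain ⟨C2, h2⟩ := φ.decay 2 0
  obtain ⟨C4, h4⟩ := φ.decay 4 0
  simp only [norm_iteratedFDeriv_zero] at h0 h2 h4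
  refine ⟨C0 + 2 * C2 + C4, ?_, fun x => ?_⟩
  · have a0 := h0.2 0
    have a2 := h2.2 0
    have a4 := h4.2 0
    simp at a0 a2 a4
    have := norm_nonneg (φ 0)
    linarith
  · rw [le_div_iff₀ (by positivity)]
    have a0 := h0.2 x
    have a2 := h2.2 x
    have a4 := h4.2 x
    nlinarith

/-- The factor r² of the radial measure absorbs the singularity 1/r. This is the spatial majorant
for exchanging the time and space integrals. -/
lemma integrable_const_div_norm_mul_schwartz (C : ℝ) (φ : 𝓢(Space, ℂ)) :
    Integrable fun x : Space => C / ‖x‖ * ‖φ x‖ := by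
  obtain ⟨M, hM0, hM⟩ := exists_norm_schwartz_le φ
  have h := integrable_radial_of_mul_le (F := fun r => |C| / r * (M / (1 + r ^ 2) ^ 2))
    (by fun_prop) (C := |C| * M) fun r hr => by
      rw [abs_of_nonneg (by positivity)]
      have : r ^ 2 * (|C| / r * (M / (1 + r ^ 2) ^ 2)) = |C| * M * (r / (1 + r ^ 2)) / (1 + r ^ 2) := by
        field_simp
      have hle : r / (1 + r ^ 2) ≤ 1 := by
        rw [div_le_one (by positivity)]
        nlinarith [sq_nonneg (r - 1)]
      rw [this]
      exact div_le_div_of_nonneg_right (mul_le_of_le_one_right (by positivity) hle) (by positivity)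
  refine h.mono ((by fun_prop : Measurable fun x : Space => C / ‖x‖).mul
    φ.continuous.norm.measurable).aestronglyMeasurable (Filter.Eventually.of_forall fun x => ?_)
  rw [norm_mul, norm_norm, Complex.norm_real, norm_mul, norm_div, norm_div, norm_norm,
    Real.norm_eq_abs, Real.norm_eq_abs |C|, abs_abs, Real.norm_of_nonneg
    (show 0 ≤ M / (1 + ‖x‖ ^ 2) ^ 2 by positivity)]
  exact mul_le_mul_of_nonneg_left (hM x) (by positivity)

lemma continuous_windowIntegral_waveProfile_cube (θ t : ℝ) : Continuous fun z : ℝ × ℝ =>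
    windowIntegral (fun ρ => ρ * waveProfile θ z.1 ρ ^ 3) (t - z.1) z.2 := by
  have hf : Continuous (Function.uncurry fun (z : ℝ × ℝ) (ρ : ℝ) => ρ * waveProfile θ z.1 ρ ^ 3) := by
    unfold Function.uncurry
    have := (continuous_waveProfile θ).comp
      (by fun_prop : Continuous fun w : (ℝ × ℝ) × ℝ => (w.1.1, w.2))
    exact continuous_snd.mul (this.pow 3)
  have hc : ∀ s : ℝ, Continuous fun ρ => ρ * waveProfile θ s ρ ^ 3 := fun s =>
    hf.comp (by fun_prop : Continuous fun ρ : ℝ => (((s, 0) : ℝ × ℝ), ρ))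
  have h1 := intervalIntegral.continuous_parametric_intervalIntegral_of_continuous (a₀ := 0)
    (μ := volume) hf (s := fun z => z.2 + (t - z.1)) (by fun_prop)
  have h2 := intervalIntegral.continuous_parametric_intervalIntegral_of_continuous (a₀ := 0)
    (μ := volume) hf (s := fun z => z.2 - (t - z.1)) (by fun_prop)
  refine (h1.sub h2).congr fun z => ?_
  exact intervalIntegral.integral_interval_sub_left
    ((hc z.1).intervalIntegrable _ _) ((hc z.1).intervalIntegrable _ _)

lemma continuous_mul_waveProfile_cube (θ s : ℝ) : Continuous fun ρ => ρ * waveProfile θ s ρ ^ 3 :=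
  continuous_id.mul (((continuous_waveProfile θ).comp
    (by fun_prop : Continuous fun ρ : ℝ => (s, ρ))).pow 3)

lemma abs_windowIntegral_le_integral_abs {g : ℝ → ℝ} (hg : Integrable g) {τ : ℝ} (hτ : 0 ≤ τ) (r : ℝ) :
    |windowIntegral g τ r| ≤ ∫ ρ, |g ρ| := by
  rw [windowIntegral, ← Real.norm_eq_abs]
  refine (intervalIntegral.norm_integral_le_integral_norm (by linarith)).trans ?_
  rw [intervalIntegral.integral_of_le (by linarith)]
  exact setIntegral_le_integral hg.norm (Filter.Eventually.of_forall fun _ => norm_nonneg _)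

lemma integrable_slice_mul_waveProfile_cube (θ s : ℝ) :
    Integrable fun ρ => ρ * waveProfile θ s ρ ^ 3 :=
  integrable_of_one_add_abs_mul_le (continuous_mul_waveProfile_cube θ s)
    (one_add_abs_mul_le (abs_waveProfile_cube_le θ s))

/-- Duhamel's formula for the cube of the wave, in its weak form. -/
lemma integral_integral_waveProfile_cube_mul_sinPropagator (θ t : ℝ) (φ : 𝓢(Space, ℂ)) :
    ∫ s in Set.Iio t, ∫ x : Space, ((waveProfile θ s ‖x‖ ^ 3 : ℝ) : ℂ) * sinPropagator (t - s) φ x =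
      ∫ x : Space, ((nullPotential θ (Real.arctan (t + ‖x‖)) (Real.arctan (t - ‖x‖)) / ‖x‖ : ℝ) : ℂ) *
        φ x := by
  set W : ℝ → ℝ → ℝ := fun s r => windowIntegral (fun ρ => ρ * waveProfile θ s ρ ^ 3) (t - s) r with hW
  have hWc : Continuous fun z : ℝ × ℝ => W z.1 z.2 := continuous_windowIntegral_waveProfile_cube θ t
  have hgi := integrable_mul_waveProfile_cube θ
  rw [Measure.volume_eq_prod] at hgi
  have hgn := hgi.integral_norm_prod_left
  set M := ∫ s, ∫ ρ, ‖ρ * waveProfile θ s ρ ^ 3‖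
  -- Enlarging the window to the whole line gives a bound uniform in r and integrable in s.
  have hWle : ∀ s, s < t → ∀ r, ‖W s r‖ ≤ ∫ ρ, ‖ρ * waveProfile θ s ρ ^ 3‖ := fun s hs r =>
    abs_windowIntegral_le_integral_abs (integrable_slice_mul_waveProfile_cube θ s)
      (by linarith : 0 ≤ t - s) r
  have hWi : ∀ r, IntegrableOn (fun s => W s r) (Set.Iio t) := fun r =>
    hgn.integrableOn.mono' (hWc.comp (by fun_prop : Continuous fun s : ℝ => (s, r))).aestronglyMeasurable
      ((ae_restrict_iff' measurableSet_Iio).2 (Filter.Eventually.of_forall fun s hs => hWle s hs r))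
  have hWM : ∀ r, ∫ s in Set.Iio t, ‖W s r‖ ≤ M := fun r =>
    (setIntegral_mono_on (hWi r).norm hgn.integrableOn measurableSet_Iio
      fun s hs => hWle s hs r).trans (setIntegral_le_integral hgn
        (Filter.Eventually.of_forall fun s => integral_nonneg fun _ => norm_nonneg _))
  have e1 : ∫ s in Set.Iio t, ∫ x : Space, ((waveProfile θ s ‖x‖ ^ 3 : ℝ) : ℂ) *
      sinPropagator (t - s) φ x =
      ∫ s in Set.Iio t, ∫ x : Space, ((1 / (2 * ‖x‖) * W s ‖x‖ : ℝ) : ℂ) * φ x := by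
    refine setIntegral_congr_fun measurableSet_Iio fun s hs => ?_
    have hs : s < t := hs
    exact integral_mul_sinPropagator (F := fun ρ => waveProfile θ s ρ ^ 3)
      (((continuous_waveProfile θ).comp (by fun_prop : Continuous fun ρ : ℝ => (s, ρ))).pow 3)
      (fun r => by rw [waveProfile_neg]) (abs_waveProfile_cube_le θ s) (by linarith : 0 ≤ t - s) φ
  rw [e1, integral_integral_swap]
  · refine integral_congr_ae (Filter.Eventually.of_forall fun x => ?_)
    simp only
    rw [integral_mul_const, integral_complex_ofReal, integral_const_mul,
      integral_windowIntegral_waveProfile_cube]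
    congr 2
    ring
  · have hm : AEStronglyMeasurable (Function.uncurry fun (s : ℝ) (x : Space) =>
        ((1 / (2 * ‖x‖) * W s ‖x‖ : ℝ) : ℂ) * φ x)
        ((volume.restrict (Set.Iio t)).prod (volume : Measure Space)) := by
      refine Measurable.aestronglyMeasurable ?_
      have h1 : Measurable fun z : ℝ × Space => W z.1 ‖z.2‖ :=
        (hWc.comp (by fun_prop : Continuous fun z : ℝ × Space => (z.1, ‖z.2‖))).measurable
      have h2 : Measurable fun z : ℝ × Space => 1 / (2 * ‖z.2‖) := by fun_prop
      have h3 : Measurable fun z : ℝ × Space => φ z.2 := (φ.continuous.comp continuous_snd).measurable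
      exact (Complex.measurable_ofReal.comp (h2.mul h1)).mul h3
    rw [integrable_prod_iff' hm]
    have hnorm : ∀ (s : ℝ) (x : Space), ‖((1 / (2 * ‖x‖) * W s ‖x‖ : ℝ) : ℂ) * φ x‖ =
        1 / (2 * ‖x‖) * ‖φ x‖ * ‖W s ‖x‖‖ := by
      intro s x
      rw [norm_mul, Complex.norm_real, norm_mul, Real.norm_of_nonneg
        (by positivity : 0 ≤ 1 / (2 * ‖x‖))]
      ring
    refine ⟨Filter.Eventually.of_forall fun x => ?_, ?_⟩
    · have := (((hWi ‖x‖).const_mul (1 / (2 * ‖x‖))).ofReal (𝕜 := ℂ)).mul_const (φ x)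
      exact this
    · refine (integrable_const_div_norm_mul_schwartz (M / 2) φ).mono'
        hm.norm.prod_swap.integral_prod_right' (Filter.Eventually.of_forall fun x => ?_)
      simp only [Function.uncurry, hnorm]
      rw [integral_const_mul, Real.norm_of_nonneg (by positivity)]
      calc _ ≤ 1 / (2 * ‖x‖) * ‖φ x‖ * M := mul_le_mul_of_nonneg_left (hWM _) (by positivity)
        _ = _ := by ring

/-! ### Closed form of the potential and pointwise bounds. -/

/-- Use cos³ y = (3 cos y + cos 3y)/4, then product-to-sum formulas. -/
lemma nullSource_eq (θ a b : ℝ) : nullSource θ a b =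
    3 / 8 * (Real.sin (2 * a - θ) - Real.sin (2 * b - θ)) +
      1 / 8 * (Real.sin (4 * a + 2 * b - 3 * θ) - Real.sin (2 * a + 4 * b - 3 * θ)) := by
  have h3 := Real.cos_three_mul (a + b - θ)
  rw [nullSource, show 2 * a - θ = (a - b) + (a + b - θ) by ring,
    show 2 * b - θ = (a + b - θ) - (a - b) by ring,
    show 4 * a + 2 * b - 3 * θ = (a - b) + 3 * (a + b - θ) by ring,
    show 2 * a + 4 * b - 3 * θ = 3 * (a + b - θ) - (a - b) by ring]
  generalize a + b - θ = y at *
  generalize a - b = x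
  rw [Real.sin_add, Real.sin_sub, Real.sin_add, Real.sin_sub, h3]
  ring

lemma hasDerivAt_linear (m c x : ℝ) : HasDerivAt (fun x : ℝ => m * x + c) m x := by
  simpa using ((hasDerivAt_id x).const_mul m).add_const c

lemma nullPotential_eq (θ A B : ℝ) : nullPotential θ A B =
    3 / 16 * ((Real.cos θ + Real.cos (2 * B - θ)) * (A + Real.pi / 2) -
        (Real.cos θ + Real.cos (2 * A - θ)) * (B + Real.pi / 2)) -
      1 / 64 * (Real.sin (4 * A + 2 * B - 3 * θ) - Real.sin (2 * A + 4 * B - 3 * θ) +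
        Real.sin (4 * A - 3 * θ) + Real.sin (2 * A - 3 * θ) -
        Real.sin (2 * B - 3 * θ) - Real.sin (4 * B - 3 * θ)) := by
  have hin : ∀ a, ∫ b in (-(Real.pi / 2))..B, nullSource θ a b =
      3 / 8 * (Real.sin (2 * a + -θ) * (B + Real.pi / 2) + (Real.cos (2 * B - θ) + Real.cos θ) / 2) -
      1 / 16 * Real.cos (4 * a + (2 * B - 3 * θ)) - 1 / 16 * Real.cos (4 * a + (- 3 * θ)) +
      1 / 32 * Real.cos (2 * a + (4 * B - 3 * θ)) - 1 / 32 * Real.cos (2 * a + (-3 * θ)) := by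
    intro a
    have hd : ∀ b ∈ Set.uIcc (-(Real.pi / 2)) B, HasDerivAt (fun b =>
        3 / 8 * (Real.sin (2 * a - θ) * b + 1 / 2 * Real.cos (2 * b + -θ)) -
          1 / 16 * Real.cos (2 * b + (4 * a - 3 * θ)) + 1 / 32 * Real.cos (4 * b + (2 * a - 3 * θ)))
        (nullSource θ a b) b := by
      intro b _
      have := ((((hasDerivAt_id b).const_mul (Real.sin (2 * a - θ))).add
        ((hasDerivAt_linear 2 (-θ) b).cos.const_mul (1 / 2))).const_mul (3 / 8)).sub
        ((hasDerivAt_linear 2 (4 * a - 3 * θ) b).cos.const_mul (1 / 16)) |>.add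
        ((hasDerivAt_linear 4 (2 * a - 3 * θ) b).cos.const_mul (1 / 32))
      refine this.congr_deriv ?_
      rw [nullSource_eq, show 2 * b + (4 * a - 3 * θ) = 4 * a + 2 * b - 3 * θ by ring,
        show 4 * b + (2 * a - 3 * θ) = 2 * a + 4 * b - 3 * θ by ring,
        show 2 * b + -θ = 2 * b - θ by ring]
      ring
    rw [intervalIntegral.integral_eq_sub_of_hasDerivAt hd
      (Continuous.intervalIntegrable (by unfold nullSource; fun_prop) _ _)]
    have e1 : Real.cos (2 * -(Real.pi / 2) + -θ) = -Real.cos θ := by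
      rw [show 2 * -(Real.pi / 2) + -θ = -(θ + Real.pi) by ring, Real.cos_neg, Real.cos_add_pi]
    have e2 : Real.cos (2 * -(Real.pi / 2) + (4 * a - 3 * θ)) = -Real.cos (4 * a + (-3 * θ)) := by
      rw [show 2 * -(Real.pi / 2) + (4 * a - 3 * θ) = (4 * a + (-3 * θ)) - Real.pi by ring,
        Real.cos_sub_pi]
    have e3 : Real.cos (4 * -(Real.pi / 2) + (2 * a - 3 * θ)) = Real.cos (2 * a + (-3 * θ)) := by
      rw [show 4 * -(Real.pi / 2) + (2 * a - 3 * θ) = (2 * a + (-3 * θ)) - 2 * Real.pi by ring,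
        Real.cos_sub_two_pi]
    rw [e1, e2, e3, show 2 * B + (4 * a - 3 * θ) = 4 * a + (2 * B - 3 * θ) by ring,
      show 4 * B + (2 * a - 3 * θ) = 2 * a + (4 * B - 3 * θ) by ring,
      show 2 * B + -θ = 2 * B - θ by ring, show 2 * a + -θ = 2 * a - θ by ring]
    ring
  rw [nullPotential]
  simp only [hin]
  have hd : ∀ a ∈ Set.uIcc (-(Real.pi / 2)) A, HasDerivAt (fun a =>
      3 / 8 * ((-(1 / 2) * (B + Real.pi / 2)) * Real.cos (2 * a + -θ) +
        ((Real.cos (2 * B - θ) + Real.cos θ) / 2) * a) -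
      1 / 64 * Real.sin (4 * a + (2 * B - 3 * θ)) - 1 / 64 * Real.sin (4 * a + (- 3 * θ)) +
      1 / 64 * Real.sin (2 * a + (4 * B - 3 * θ)) - 1 / 64 * Real.sin (2 * a + (-3 * θ)))
      (3 / 8 * (Real.sin (2 * a + -θ) * (B + Real.pi / 2) + (Real.cos (2 * B - θ) + Real.cos θ) / 2) -
      1 / 16 * Real.cos (4 * a + (2 * B - 3 * θ)) - 1 / 16 * Real.cos (4 * a + (- 3 * θ)) +
      1 / 32 * Real.cos (2 * a + (4 * B - 3 * θ)) - 1 / 32 * Real.cos (2 * a + (-3 * θ))) a := by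
    intro a _
    have := ((((((hasDerivAt_linear 2 (-θ) a).cos.const_mul (-(1 / 2) * (B + Real.pi / 2))).add
      ((hasDerivAt_id a).const_mul ((Real.cos (2 * B - θ) + Real.cos θ) / 2))).const_mul (3 / 8)).sub
      ((hasDerivAt_linear 4 (2 * B - 3 * θ) a).sin.const_mul (1 / 64))).sub
      ((hasDerivAt_linear 4 (-3 * θ) a).sin.const_mul (1 / 64))).add
      ((hasDerivAt_linear 2 (4 * B - 3 * θ) a).sin.const_mul (1 / 64)) |>.sub
      ((hasDerivAt_linear 2 (-3 * θ) a).sin.const_mul (1 / 64))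
    refine this.congr_deriv ?_
    ring
  rw [intervalIntegral.integral_eq_sub_of_hasDerivAt hd
    (Continuous.intervalIntegrable (by fun_prop) _ _)]
  have e1 : Real.cos (2 * -(Real.pi / 2) + -θ) = -Real.cos θ := by
    rw [show 2 * -(Real.pi / 2) + -θ = -(θ + Real.pi) by ring, Real.cos_neg, Real.cos_add_pi]
  have e2 : ∀ y, Real.sin (4 * -(Real.pi / 2) + y) = Real.sin y := fun y => by
    rw [show 4 * -(Real.pi / 2) + y = y - 2 * Real.pi by ring, Real.sin_sub_two_pi]
  have e3 : ∀ y, Real.sin (2 * -(Real.pi / 2) + y) = -Real.sin y := fun y => by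
    rw [show 2 * -(Real.pi / 2) + y = y - Real.pi by ring, Real.sin_sub_pi]
  rw [e1, e2, e2, e3, e3, show 4 * A + (2 * B - 3 * θ) = 4 * A + 2 * B - 3 * θ by ring,
    show 2 * A + (4 * B - 3 * θ) = 2 * A + 4 * B - 3 * θ by ring,
    show 4 * A + -3 * θ = 4 * A - 3 * θ by ring, show 2 * A + -3 * θ = 2 * A - 3 * θ by ring,
    show 2 * A + -θ = 2 * A - θ by ring]
  ring

@[fun_prop]
lemma continuous_nullPotential (θ : ℝ) : Continuous fun z : ℝ × ℝ => nullPotential θ z.1 z.2 := by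
  simp only [nullPotential_eq]
  fun_prop

/-- This mirrors the factor sin(a - b) of the source. It yields vanishing at r = 0 and evenness in r
of the retarded solution. -/
lemma nullPotential_swap (θ A B : ℝ) : nullPotential θ B A = -nullPotential θ A B := by
  rw [nullPotential_eq, nullPotential_eq, show 4 * B + 2 * A - 3 * θ = 2 * A + 4 * B - 3 * θ by ring,
    show 2 * B + 4 * A - 3 * θ = 4 * A + 2 * B - 3 * θ by ring]
  ring

lemma nullPotential_self (θ A : ℝ) : nullPotential θ A A = 0 := by
  have := nullPotential_swap θ A A
  linarith

lemma continuous_nullSource_fst (θ B : ℝ) :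
    Continuous fun a => ∫ b in (-(Real.pi / 2))..B, nullSource θ a b :=
  intervalIntegral.continuous_parametric_intervalIntegral_of_continuous'
    (f := fun a b => nullSource θ a b) (by unfold nullSource Function.uncurry; fun_prop) _ _

/-- Vanishing on the diagonal lets the rectangle be cut down to B ≤ a ≤ A, -π/2 ≤ b ≤ B, on which
the source is at most 1 in absolute value. -/
lemma abs_nullPotential_le_mul (θ : ℝ) {A B : ℝ} (hB : -(Real.pi / 2) ≤ B) (hAB : B ≤ A) :
    |nullPotential θ A B| ≤ (A - B) * (B + Real.pi / 2) := by
  have h1 : nullPotential θ A B =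
      ∫ a in B..A, ∫ b in (-(Real.pi / 2))..B, nullSource θ a b := by
    rw [← sub_zero (nullPotential θ A B), ← nullPotential_self θ B, nullPotential, nullPotential,
      intervalIntegral.integral_interval_sub_left
        ((continuous_nullSource_fst θ B).intervalIntegrable _ _)
        ((continuous_nullSource_fst θ B).intervalIntegrable _ _)]
  have h2 : ∀ a, ‖∫ b in (-(Real.pi / 2))..B, nullSource θ a b‖ ≤ B + Real.pi / 2 := by
    intro a
    have := intervalIntegral.norm_integral_le_of_norm_le_const (a := -(Real.pi / 2)) (b := B)
      (f := nullSource θ a) (C := 1) fun b _ => abs_nullSource_le θ a b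
    rwa [one_mul, sub_neg_eq_add, abs_of_nonneg (by linarith)] at this
  rw [h1, ← Real.norm_eq_abs]
  have := intervalIntegral.norm_integral_le_of_norm_le_const (a := B) (b := A)
    fun a _ => h2 a
  rwa [abs_of_nonneg (by linarith), mul_comm] at this

/-- Jordan's inequality on [0, π/2], carried to [π/2, π] by the symmetry R ↦ π - R. -/
lemma mul_pi_sub_le_sin {R : ℝ} (h0 : 0 ≤ R) (hR : R ≤ Real.pi) :
    R * (Real.pi - R) ≤ Real.pi ^ 2 / 2 * Real.sin R := by
  have hpi := Real.pi_pos
  have key : ∀ x, 0 ≤ x → x ≤ Real.pi / 2 → x * (Real.pi - x) ≤ Real.pi ^ 2 / 2 * Real.sin x := by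
    intro x hx hx2
    have h := mul_le_mul_of_nonneg_left (Real.mul_le_sin hx hx2) (by positivity : 0 ≤ Real.pi ^ 2 / 2)
    have h2 : Real.pi ^ 2 / 2 * (2 / Real.pi * x) = Real.pi * x := by field_simp
    nlinarith
  rcases le_total R (Real.pi / 2) with h | h
  · exact key R h0 h
  · have := key (Real.pi - R) (by linarith) (by linarith)
    rw [Real.sin_pi_sub] at this
    linarith

/-- With R = A - B and A ≤ π/2, one has B + π/2 ≤ π - R. As sin R = rΩ, dividing by r bounds the
retarded solution by a multiple of Ω. -/
lemma abs_nullPotential_le_sin (θ : ℝ) {A B : ℝ} (hB : -(Real.pi / 2) ≤ B) (hAB : B ≤ A)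
    (hA : A ≤ Real.pi / 2) : |nullPotential θ A B| ≤ Real.pi ^ 2 / 2 * Real.sin (A - B) := by
  refine (abs_nullPotential_le_mul θ hB hAB).trans (le_trans ?_
    (mul_pi_sub_le_sin (by linarith) (by linarith)))
  exact mul_le_mul_of_nonneg_left (by linarith) (by linarith)

/-- The radial profile of the retarded solution with source the cube of the wave. -/
noncomputable def retardedProfile (θ t r : ℝ) : ℝ :=
  nullPotential θ (Real.arctan (t + r)) (Real.arctan (t - r)) / r

lemma abs_retardedProfile_le (θ t : ℝ) {r : ℝ} (hr : 0 ≤ r) :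
    |retardedProfile θ t r| ≤ Real.pi ^ 2 / 2 * radialConformalFactor t r := by
  rcases hr.eq_or_lt with h0 | h0
  -- At r = 0 the profile has the default value 0 of division by zero.
  · rw [retardedProfile, ← h0, div_zero, abs_zero]
    have := radialConformalFactor_pos t 0
    positivity
  · rw [retardedProfile, abs_div, abs_of_pos h0, div_le_iff₀ h0]
    refine (abs_nullPotential_le_sin θ (Real.neg_pi_div_two_lt_arctan _).le
      (Real.arctan_mono (by linarith)) (Real.arctan_lt_pi_div_two _).le).trans ?_
    rw [← mul_radialConformalFactor]
    linarith

lemma retardedProfile_neg (θ t r : ℝ) : retardedProfile θ t (-r) = retardedProfile θ t r := by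
  rw [retardedProfile, retardedProfile, ← sub_eq_add_neg, sub_neg_eq_add, nullPotential_swap, neg_div_neg_eq]

lemma measurable_retardedProfile (θ : ℝ) : Measurable fun z : ℝ × ℝ => retardedProfile θ z.1 z.2 := by
  unfold retardedProfile
  exact ((continuous_nullPotential θ).comp (by fun_prop : Continuous fun z : ℝ × ℝ =>
    (Real.arctan (z.1 + z.2), Real.arctan (z.1 - z.2)))).measurable.div measurable_snd

/-! ### Integration of source times potential over the null square. -/

/-- A trigonometric polynomial of degree two in `2 x`. -/
noncomputable def trigPoly (α₀ α₁ α₂ α₃ α₄ x : ℝ) : ℝ :=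
  α₀ + α₁ * Real.sin (2 * x) + α₂ * Real.cos (2 * x) + α₃ * Real.sin (4 * x) + α₄ * Real.cos (4 * x)

@[fun_prop]
lemma continuous_trigPoly (α₀ α₁ α₂ α₃ α₄ : ℝ) : Continuous (trigPoly α₀ α₁ α₂ α₃ α₄) := by
  unfold trigPoly
  fun_prop

/-- Orthogonality leaves only the diagonal products; against x only the sines survive, with ∫ x sin
2x = π/2 and ∫ x sin 4x = -π/4. -/
lemma integral_trigPoly_mul (α₀ α₁ α₂ α₃ α₄ β₀ β₁ β₂ β₃ β₄ β₅ : ℝ) :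
    ∫ x in (-(Real.pi / 2))..(Real.pi / 2),
      trigPoly α₀ α₁ α₂ α₃ α₄ x * (trigPoly β₀ β₁ β₂ β₃ β₄ x + β₅ * x) =
    Real.pi * α₀ * β₀ + Real.pi / 2 * (α₁ * β₁ + α₂ * β₂ + α₃ * β₃ + α₄ * β₄) +
      β₅ * (Real.pi / 2 * α₁ - Real.pi / 4 * α₃) := by
  have hs : ∀ m x : ℝ, HasDerivAt (fun x : ℝ => Real.sin (m * x)) (m * Real.cos (m * x)) x := by
    intro m x
    have := (hasDerivAt_linear m 0 x).sin
    simpa [mul_comm] using this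
  have hc : ∀ m x : ℝ, HasDerivAt (fun x : ℝ => Real.cos (m * x)) (-(m * Real.sin (m * x))) x := by
    intro m x
    have := (hasDerivAt_linear m 0 x).cos
    simpa [mul_comm] using this
  have hd : ∀ x ∈ Set.uIcc (-(Real.pi / 2)) (Real.pi / 2), HasDerivAt (fun x : ℝ =>
      (α₀ * β₀ + (α₁ * β₁ + α₂ * β₂ + α₃ * β₃ + α₄ * β₄) / 2) * x + α₀ * β₅ / 2 * x ^ 2 +
      (α₀ * β₂ + α₂ * β₀ + (α₁ * β₃ + α₃ * β₁ + α₂ * β₄ + α₄ * β₂) / 2) / 2 * Real.sin (2 * x) +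
      (-(α₀ * β₁ + α₁ * β₀ + (α₃ * β₂ + α₂ * β₃ - α₁ * β₄ - α₄ * β₁) / 2) / 2) * Real.cos (2 * x) +
      (α₀ * β₄ + α₄ * β₀ + (α₂ * β₂ - α₁ * β₁) / 2) / 4 * Real.sin (4 * x) +
      (-(α₀ * β₃ + α₃ * β₀ + (α₁ * β₂ + α₂ * β₁) / 2) / 4) * Real.cos (4 * x) +
      (α₂ * β₄ + α₄ * β₂ - α₁ * β₃ - α₃ * β₁) / 12 * Real.sin (6 * x) +
      (-(α₃ * β₂ + α₂ * β₃ + α₁ * β₄ + α₄ * β₁) / 12) * Real.cos (6 * x) +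
      (α₄ * β₄ - α₃ * β₃) / 16 * Real.sin (8 * x) +
      (-(α₃ * β₄ + α₄ * β₃) / 16) * Real.cos (8 * x) +
      β₅ * (α₁ * (1 / 4 * Real.sin (2 * x) - x * Real.cos (2 * x) * (1 / 2)) +
        α₂ * (1 / 4 * Real.cos (2 * x) + x * Real.sin (2 * x) * (1 / 2)) +
        α₃ * (1 / 16 * Real.sin (4 * x) - x * Real.cos (4 * x) * (1 / 4)) +
        α₄ * (1 / 16 * Real.cos (4 * x) + x * Real.sin (4 * x) * (1 / 4))))
      (trigPoly α₀ α₁ α₂ α₃ α₄ x * (trigPoly β₀ β₁ β₂ β₃ β₄ x + β₅ * x)) x := by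
    intro x _
    have hx := hasDerivAt_id x
    have d := ((((((((((hx.const_mul (α₀ * β₀ + (α₁ * β₁ + α₂ * β₂ + α₃ * β₃ + α₄ * β₄) / 2)).add
      ((hasDerivAt_pow 2 x).const_mul (α₀ * β₅ / 2))).add
      ((hs 2 x).const_mul ((α₀ * β₂ + α₂ * β₀ + (α₁ * β₃ + α₃ * β₁ + α₂ * β₄ + α₄ * β₂) / 2) / 2))).add
      ((hc 2 x).const_mul (-(α₀ * β₁ + α₁ * β₀ + (α₃ * β₂ + α₂ * β₃ - α₁ * β₄ - α₄ * β₁) / 2) / 2))).add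
      ((hs 4 x).const_mul ((α₀ * β₄ + α₄ * β₀ + (α₂ * β₂ - α₁ * β₁) / 2) / 4))).add
      ((hc 4 x).const_mul (-(α₀ * β₃ + α₃ * β₀ + (α₁ * β₂ + α₂ * β₁) / 2) / 4))).add
      ((hs 6 x).const_mul ((α₂ * β₄ + α₄ * β₂ - α₁ * β₃ - α₃ * β₁) / 12))).add
      ((hc 6 x).const_mul (-(α₃ * β₂ + α₂ * β₃ + α₁ * β₄ + α₄ * β₁) / 12))).add
      ((hs 8 x).const_mul ((α₄ * β₄ - α₃ * β₃) / 16))).add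
      ((hc 8 x).const_mul (-(α₃ * β₄ + α₄ * β₃) / 16))).add
      (((((((hs 2 x).const_mul (1 / 4)).sub ((hx.mul (hc 2 x)).mul_const (1 / 2))).const_mul α₁).add
        ((((hc 2 x).const_mul (1 / 4)).add ((hx.mul (hs 2 x)).mul_const (1 / 2))).const_mul α₂)).add
        ((((hs 4 x).const_mul (1 / 16)).sub ((hx.mul (hc 4 x)).mul_const (1 / 4))).const_mul α₃)).add
        ((((hc 4 x).const_mul (1 / 16)).add ((hx.mul (hs 4 x)).mul_const (1 / 4))).const_mul α₄)
        |>.const_mul β₅)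
    refine d.congr_deriv ?_
    have e2 : Real.sin (2 * x) ^ 2 + Real.cos (2 * x) ^ 2 = 1 := Real.sin_sq_add_cos_sq _
    have e4s : Real.sin (4 * x) = 2 * Real.sin (2 * x) * Real.cos (2 * x) := by
      rw [show 4 * x = 2 * (2 * x) by ring, Real.sin_two_mul]
    have e4c : Real.cos (4 * x) = 1 - 2 * Real.sin (2 * x) ^ 2 := by
      rw [show 4 * x = 2 * (2 * x) by ring, Real.cos_two_mul, Real.cos_sq']
      ring
    have e4 : Real.sin (4 * x) ^ 2 + Real.cos (4 * x) ^ 2 = 1 := Real.sin_sq_add_cos_sq _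
    have e6s : Real.sin (6 * x) =
        Real.sin (4 * x) * Real.cos (2 * x) + Real.cos (4 * x) * Real.sin (2 * x) := by
      rw [← Real.sin_add]; ring_nf
    have e6c : Real.cos (6 * x) =
        Real.cos (4 * x) * Real.cos (2 * x) - Real.sin (4 * x) * Real.sin (2 * x) := by
      rw [← Real.cos_add]; ring_nf
    have e8s : Real.sin (8 * x) = 2 * Real.sin (4 * x) * Real.cos (4 * x) := by
      rw [show 8 * x = 2 * (4 * x) by ring, Real.sin_two_mul]
    have e8c : Real.cos (8 * x) = 1 - 2 * Real.sin (4 * x) ^ 2 := by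
      rw [show 8 * x = 2 * (4 * x) by ring, Real.cos_two_mul, Real.cos_sq']
      ring
    have f1 : Real.cos (2 * x) = Real.cos (4 * x) * Real.cos (2 * x) + Real.sin (4 * x) * Real.sin (2 * x) := by
      rw [← Real.cos_sub]; ring_nf
    have f2 : Real.sin (2 * x) = Real.sin (4 * x) * Real.cos (2 * x) - Real.cos (4 * x) * Real.sin (2 * x) := by
      rw [← Real.sin_sub]; ring_nf
    simp only [trigPoly, id, Nat.cast_ofNat]
    rw [e6s, e6c, e8s, e8c]
    linear_combination (-(α₁ * β₁) / 2 + α₂ * β₂ / 2) * e4c - α₂ * β₂ * e2 +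
      (α₁ * β₂ + α₂ * β₁) / 2 * e4s + (α₁ * β₃ + α₃ * β₁ + α₂ * β₄ + α₄ * β₂) / 2 * f1 +
      (α₃ * β₂ + α₂ * β₃ - α₁ * β₄ - α₄ * β₁) / 2 * f2 - α₄ * β₄ * e4
  rw [intervalIntegral.integral_eq_sub_of_hasDerivAt hd
    (Continuous.intervalIntegrable (by fun_prop) _ _)]
  have s2 : Real.sin (2 * (Real.pi / 2)) = 0 := by
    rw [show 2 * (Real.pi / 2) = Real.pi by ring, Real.sin_pi]
  have c2 : Real.cos (2 * (Real.pi / 2)) = -1 := by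
    rw [show 2 * (Real.pi / 2) = Real.pi by ring, Real.cos_pi]
  have s4 : Real.sin (4 * (Real.pi / 2)) = 0 := by
    rw [show 4 * (Real.pi / 2) = 2 * Real.pi by ring, Real.sin_two_pi]
  have c4 : Real.cos (4 * (Real.pi / 2)) = 1 := by
    rw [show 4 * (Real.pi / 2) = 2 * Real.pi by ring, Real.cos_two_pi]
  have s6 : Real.sin (6 * (Real.pi / 2)) = 0 := by
    rw [show 6 * (Real.pi / 2) = (3 : ℕ) * Real.pi by push_cast; ring, Real.sin_nat_mul_pi]
  have s8 : Real.sin (8 * (Real.pi / 2)) = 0 := by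
    rw [show 8 * (Real.pi / 2) = (4 : ℕ) * Real.pi by push_cast; ring, Real.sin_nat_mul_pi]
  simp only [mul_neg, Real.sin_neg, Real.cos_neg, s2, c2, s4, c4, s6, s8]
  ring

lemma nullSource_eq_trigPoly (θ a b : ℝ) : nullSource θ a b =
    trigPoly (trigPoly 0 (3 / 8 * Real.cos θ) (-(3 / 8 * Real.sin θ)) 0 0 a)
      (trigPoly (-(3 / 8 * Real.cos θ)) 0 0 (1 / 8 * Real.sin (3 * θ)) (1 / 8 * Real.cos (3 * θ)) a)
      (trigPoly (3 / 8 * Real.sin θ) 0 0 (1 / 8 * Real.cos (3 * θ)) (-(1 / 8 * Real.sin (3 * θ))) a)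
      (trigPoly 0 (-(1 / 8 * Real.sin (3 * θ))) (-(1 / 8 * Real.cos (3 * θ))) 0 0 a)
      (trigPoly 0 (-(1 / 8 * Real.cos (3 * θ))) (1 / 8 * Real.sin (3 * θ)) 0 0 a) b := by
  rw [nullSource_eq, show 4 * a + 2 * b - 3 * θ = 4 * a - 3 * θ + 2 * b by ring,
    show 2 * a + 4 * b - 3 * θ = 2 * a - 3 * θ + 4 * b by ring]
  simp only [Real.sin_add, Real.sin_sub, Real.cos_sub, trigPoly]
  ring

/-- The coefficients in b are themselves of the form trigonometric polynomial plus linear term in a;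
the summands `0 * a` keep that shape, so one integral formula serves both variables. -/
lemma nullPotential_eq_trigPoly (θ a b : ℝ) : nullPotential θ a b =
    trigPoly
      (trigPoly 0 (-(3 / 32 * Real.pi * Real.sin θ) - 1 / 64 * Real.cos (3 * θ))
        (-(3 / 32 * Real.pi * Real.cos θ) + 1 / 64 * Real.sin (3 * θ))
        (-(1 / 64 * Real.cos (3 * θ))) (1 / 64 * Real.sin (3 * θ)) a + 3 / 16 * Real.cos θ * a)
      (trigPoly (3 / 32 * Real.pi * Real.sin θ + 1 / 64 * Real.cos (3 * θ)) 0 0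
        (-(1 / 64 * Real.sin (3 * θ))) (-(1 / 64 * Real.cos (3 * θ))) a + 3 / 16 * Real.sin θ * a)
      (trigPoly (3 / 32 * Real.pi * Real.cos θ - 1 / 64 * Real.sin (3 * θ)) 0 0
        (-(1 / 64 * Real.cos (3 * θ))) (1 / 64 * Real.sin (3 * θ)) a + 3 / 16 * Real.cos θ * a)
      (trigPoly (1 / 64 * Real.cos (3 * θ)) (1 / 64 * Real.sin (3 * θ))
        (1 / 64 * Real.cos (3 * θ)) 0 0 a + 0 * a)
      (trigPoly (-(1 / 64 * Real.sin (3 * θ))) (1 / 64 * Real.cos (3 * θ))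
        (-(1 / 64 * Real.sin (3 * θ))) 0 0 a + 0 * a) b +
    (trigPoly (-(3 / 16 * Real.cos θ)) (-(3 / 16 * Real.sin θ)) (-(3 / 16 * Real.cos θ)) 0 0 a + 0 * a) *
      b := by
  rw [nullPotential_eq, show 4 * a + 2 * b - 3 * θ = 4 * a - 3 * θ + 2 * b by ring,
    show 2 * a + 4 * b - 3 * θ = 2 * a - 3 * θ + 4 * b by ring]
  simp only [Real.sin_add, Real.sin_sub, Real.cos_sub, trigPoly]
  ring

/-- The integrand is the value of the inner b-integral. Splitting it puts each outer integral into
the form of `integral_trigPoly_mul`, with the source coefficient on the left. -/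
lemma integral_bilinear_combination {α₀ α₁ α₂ α₃ α₄ β₀ β₁ β₂ β₃ β₄ β₅ : ℝ → ℝ} (p q : ℝ)
    (hα₀ : Continuous α₀) (hα₁ : Continuous α₁) (hα₂ : Continuous α₂) (hα₃ : Continuous α₃)
    (hα₄ : Continuous α₄) (hβ₀ : Continuous β₀) (hβ₁ : Continuous β₁) (hβ₂ : Continuous β₂)
    (hβ₃ : Continuous β₃) (hβ₄ : Continuous β₄) (hβ₅ : Continuous β₅) :
    ∫ x in p..q, (Real.pi * α₀ x * β₀ x +
      Real.pi / 2 * (α₁ x * β₁ x + α₂ x * β₂ x + α₃ x * β₃ x + α₄ x * β₄ x) +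
      β₅ x * (Real.pi / 2 * α₁ x - Real.pi / 4 * α₃ x)) =
    Real.pi * (∫ x in p..q, α₀ x * β₀ x) + Real.pi / 2 * ((∫ x in p..q, α₁ x * β₁ x) +
      (∫ x in p..q, α₂ x * β₂ x) + (∫ x in p..q, α₃ x * β₃ x) + ∫ x in p..q, α₄ x * β₄ x) +
      (Real.pi / 2 * (∫ x in p..q, α₁ x * β₅ x) - Real.pi / 4 * ∫ x in p..q, α₃ x * β₅ x) := by
  have ii : ∀ {f g : ℝ → ℝ}, Continuous f → Continuous g →
      IntervalIntegrable (fun x => f x * g x) volume p q := fun hf hg =>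
    (hf.mul hg).intervalIntegrable _ _
  have h0 := ii hα₀ hβ₀
  have h1 := ii hα₁ hβ₁
  have h2 := ii hα₂ hβ₂
  have h3 := ii hα₃ hβ₃
  have h4 := ii hα₄ hβ₄
  have h5 := ii hα₁ hβ₅
  have h6 := ii hα₃ hβ₅
  simp only [← intervalIntegral.integral_const_mul]
  rw [← intervalIntegral.integral_add h1 h2, ← intervalIntegral.integral_add (h1.add h2) h3,
    ← intervalIntegral.integral_add ((h1.add h2).add h3) h4, ← intervalIntegral.integral_const_mul,
    ← intervalIntegral.integral_add (h0.const_mul _) ((((h1.add h2).add h3).add h4).const_mul _),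
    ← intervalIntegral.integral_sub (h5.const_mul _) (h6.const_mul _),
    ← intervalIntegral.integral_add ((h0.const_mul _).add ((((h1.add h2).add h3).add h4).const_mul _))
      ((h5.const_mul _).sub (h6.const_mul _))]
  refine intervalIntegral.integral_congr fun x _ => ?_
  ring

lemma setIntegral_nullSource_mul_nullPotential (θ : ℝ) :
    ∫ z in nullSquare, nullSource θ z.1 z.2 * nullPotential θ z.1 z.2 =
      Real.pi ^ 2 / 512 * (24 * Real.cos θ ^ 2 + 5) := by
  have hc : Continuous fun z : ℝ × ℝ => nullSource θ z.1 z.2 * nullPotential θ z.1 z.2 := by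
    refine Continuous.mul ?_ (continuous_nullPotential θ)
    unfold nullSource
    fun_prop
  have hi : IntegrableOn (fun z : ℝ × ℝ => nullSource θ z.1 z.2 * nullPotential θ z.1 z.2)
      nullSquare := by
    refine (hc.continuousOn.integrableOn_compact (K := Set.Icc (-(Real.pi / 2)) (Real.pi / 2) ×ˢ
      Set.Icc (-(Real.pi / 2)) (Real.pi / 2)) (isCompact_Icc.prod isCompact_Icc)).mono_set ?_
    exact Set.prod_mono Set.Ioo_subset_Icc_self Set.Ioo_subset_Icc_self
  have hpi := Real.pi_pos
  have hle : -(Real.pi / 2) ≤ Real.pi / 2 := by linarith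
  rw [nullSquare, Measure.volume_eq_prod] at *
  rw [setIntegral_prod _ hi]
  have hin : ∀ F : ℝ → ℝ, ∫ x in Set.Ioo (-(Real.pi / 2)) (Real.pi / 2), F x =
      ∫ x in (-(Real.pi / 2))..(Real.pi / 2), F x := fun F => by
    rw [intervalIntegral.integral_of_le hle, integral_Ioc_eq_integral_Ioo]
  simp only [hin, nullSource_eq_trigPoly, nullPotential_eq_trigPoly, integral_trigPoly_mul]
  rw [integral_bilinear_combination _ _ (by fun_prop) (by fun_prop) (by fun_prop) (by fun_prop)
    (by fun_prop) (by fun_prop) (by fun_prop) (by fun_prop) (by fun_prop) (by fun_prop) (by fun_prop)]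
  simp only [integral_trigPoly_mul]
  have h2 := Real.sin_sq_add_cos_sq (3 * θ)
  -- The cross terms between the first and third harmonics collapse to cos 2θ, the source of the
  -- cos² θ dependence.
  have h3 : Real.cos (3 * θ) * Real.cos θ + Real.sin (3 * θ) * Real.sin θ =
      2 * Real.cos θ ^ 2 - 1 := by
    rw [← Real.cos_sub, ← Real.cos_two_mul]
    ring_nf
  linear_combination (-3 / 256 * Real.pi ^ 2) * h3 - Real.pi ^ 2 / 512 * h2

/-! ### Radial integrals over spacetime and L⁴ bounds. -/

lemma measurePreserving_fst_norm :
    MeasurePreserving (fun p : Spacetime => (p.1, ‖p.2‖)) volume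
      ((volume : Measure ℝ).prod radialMeasure) :=
  (MeasurePreserving.id (volume : Measure ℝ)).prod measurePreserving_norm

lemma integrable_spacetime_radial {f : ℝ × ℝ → ℝ} (hf : Measurable f)
    (hi : Integrable fun z : ℝ × ℝ => z.2 ^ 2 * f z) :
    Integrable fun p : Spacetime => f (p.1, ‖p.2‖) := by
  have h1 : Integrable f ((volume : Measure ℝ).prod radialMeasure) := by
    rw [radialMeasure, prod_withDensity_right (by fun_prop),
      integrable_withDensity_iff_integrable_smul' (by fun_prop) (by simp)]
    have h2 : Integrable (fun z : ℝ × ℝ => 4 * Real.pi * (z.2 ^ 2 * f z))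
        ((volume : Measure ℝ).prod (volume.restrict (Set.Ioi 0))) := by
      refine (hi.const_mul (4 * Real.pi)).mono_measure ?_
      exact Measure.prod_mono le_rfl Measure.restrict_le_self
    refine h2.congr (Filter.Eventually.of_forall fun z => ?_)
    simp only [smul_eq_mul]
    rw [ENNReal.toReal_ofReal (by positivity), mul_assoc (4 * Real.pi)]
  exact (measurePreserving_fst_norm.integrable_comp hf.aestronglyMeasurable).2 h1

/-- The factor 4π on r > 0 becomes 2π on the whole line by evenness, so that null coordinates can
range over a full square. -/
lemma integral_spacetime_radial {f : ℝ × ℝ → ℝ} (hf : Measurable f)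
    (heven : ∀ t r, f (t, -r) = f (t, r)) (hi : Integrable fun z : ℝ × ℝ => z.2 ^ 2 * f z) :
    ∫ p : Spacetime, f (p.1, ‖p.2‖) = 2 * Real.pi * ∫ z : ℝ × ℝ, z.2 ^ 2 * f z := by
  have h1 : ∫ p : Spacetime, f (p.1, ‖p.2‖) = ∫ z, f z ∂((volume : Measure ℝ).prod radialMeasure) := by
    rw [← measurePreserving_fst_norm.map_eq, integral_map
      measurePreserving_fst_norm.measurable.aemeasurable hf.aestronglyMeasurable]
  have h2 : Integrable f ((volume : Measure ℝ).prod radialMeasure) :=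
    (measurePreserving_fst_norm.integrable_comp hf.aestronglyMeasurable).1
      (integrable_spacetime_radial hf hi)
  rw [h1, integral_prod _ h2, Measure.volume_eq_prod, integral_prod _ hi, ← integral_const_mul]
  refine integral_congr_ae (Filter.Eventually.of_forall fun t => ?_)
  simp only
  rw [integral_radialMeasure]
  simp only [smul_eq_mul]
  have := integral_Ioi_eq_half_of_even (f := fun r => r ^ 2 * f (t, r)) fun r => by
    rw [heven, neg_sq]
  simp only [mul_assoc (4 * Real.pi)]
  rw [integral_const_mul, this]
  ring

/-- Since r²Ω⁴ = (rΩ)²Ω² = 2J sin² R, this is a bounded function on the null square. Hence Ω is in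
L⁴. -/
lemma integrable_sq_mul_radialConformalFactor :
    Integrable fun z : ℝ × ℝ => z.2 ^ 2 * radialConformalFactor z.1 z.2 ^ 4 := by
  have hm : Measurable fun z : ℝ × ℝ => 2 * Real.sin (z.1 - z.2) ^ 2 := by fun_prop
  refine ((integrable_nullMap_iff hm).2 ?_).congr (Filter.Eventually.of_forall fun z => ?_)
  · refine Measure.integrableOn_of_bounded volume_nullSquare_lt_top.ne hm.aestronglyMeasurable
      (M := 2) (Filter.Eventually.of_forall fun z => ?_)
    rw [Real.norm_of_nonneg (by positivity)]
    nlinarith [Real.sin_sq_le_one (z.1 - z.2)]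
  · have h1 := mul_radialConformalFactor z.1 z.2
    have h2 := radialConformalFactor_sq z.1 z.2
    simp only [nullMap]
    rw [← h1]
    linear_combination (-(z.2 ^ 2 * radialConformalFactor z.1 z.2 ^ 2)) * h2

lemma memLp_four_of_abs_le {f : ℝ × ℝ → ℝ} (hf : Measurable f) {C : ℝ}
    (hb : ∀ t r, 0 ≤ r → |f (t, r)| ≤ C * radialConformalFactor t r) :
    MemLp (fun p : Spacetime => f (p.1, ‖p.2‖)) 4 volume := by
  have hΩm : Measurable fun z : ℝ × ℝ => radialConformalFactor z.1 z.2 ^ 4 := by fun_prop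
  have hΩ : MemLp (fun p : Spacetime => radialConformalFactor p.1 ‖p.2‖) 4 volume := by
    have hm : AEStronglyMeasurable (fun p : Spacetime => radialConformalFactor p.1 ‖p.2‖) volume :=
      (continuous_radialConformalFactor.comp
        (by fun_prop : Continuous fun p : Spacetime => (p.1, ‖p.2‖))).aestronglyMeasurable
    rw [← integrable_norm_rpow_iff hm (by norm_num) (by norm_num)]
    have := integrable_spacetime_radial hΩm integrable_sq_mul_radialConformalFactor
    refine this.congr (Filter.Eventually.of_forall fun p => ?_)
    simp only
    rw [Real.norm_of_nonneg (radialConformalFactor_pos _ _).le,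
      show (4 : ENNReal).toReal = ((4 : ℕ) : ℝ) by norm_num, Real.rpow_natCast]
  refine (hΩ.const_mul C).mono (hf.comp (by fun_prop : Measurable fun p : Spacetime =>
    (p.1, ‖p.2‖))).aestronglyMeasurable (Filter.Eventually.of_forall fun p => ?_)
  exact (hb p.1 ‖p.2‖ (norm_nonneg _)).trans (le_abs_self _)

lemma memLp_cube {f : Spacetime → ℝ} (hf : MemLp f 4 volume) :
    MemLp (fun p => f p ^ 3) (4 / 3) volume := by
  have h := hf.norm_rpow_div 3
  refine MemLp.congr_norm h (hf.1.pow 3) (Filter.Eventually.of_forall fun p => ?_)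
  rw [show (3 : ENNReal).toReal = ((3 : ℕ) : ℝ) by norm_num, Real.rpow_natCast, norm_pow, norm_norm,
    norm_pow]

/-! ### The explicit solutions, uniqueness and the value of the action. -/

/-- The wave with Penrose transform `cos (T - θ)`. -/
noncomputable def wave (θ : ℝ) (p : Spacetime) : ℝ := waveProfile θ p.1 ‖p.2‖

/-- The retarded solution with source the cube of the wave. -/
noncomputable def retardedWave (θ : ℝ) (p : Spacetime) : ℝ := retardedProfile θ p.1 ‖p.2‖

lemma memLp_wave (θ : ℝ) : MemLp (wave θ) 4 volume :=
  memLp_four_of_abs_le (f := fun z => waveProfile θ z.1 z.2) (continuous_waveProfile θ).measurable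
    (C := 1) fun t r _ => by simpa using abs_waveProfile_le θ t r

lemma memLp_retardedWave (θ : ℝ) : MemLp (retardedWave θ) 4 volume :=
  memLp_four_of_abs_le (f := fun z => retardedProfile θ z.1 z.2) (measurable_retardedProfile θ)
    fun t _ hr => abs_retardedProfile_le θ t hr

lemma integrable_mul_schwartz_of_abs_le {f : Space → ℝ} (hf : Measurable f) {C : ℝ}
    (hC : ∀ x, |f x| ≤ C) (φ : 𝓢(Space, ℂ)) : Integrable fun x => (f x : ℂ) * φ x := by
  refine φ.integrable.bdd_mul (c := C) (by fun_prop) (Filter.Eventually.of_forall fun x => ?_)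
  rw [Complex.norm_real]
  exact hC x

lemma radialConformalFactor_le_two (t r : ℝ) : radialConformalFactor t r ≤ 2 * (1 + t ^ 2) := by
  refine (radialConformalFactor_le t r).trans (div_le_self (by positivity) ?_)
  nlinarith [sq_nonneg r]

lemma isLinearWave_wave (θ : ℝ) : IsLinearWave (data₀ θ) (data₁ θ) (wave θ) where
  aestronglyMeasurable := (memLp_wave θ).1
  integrable_slice t φ := by
    refine integrable_mul_schwartz_of_abs_le (f := fun x => wave θ (t, x)) ?_ (C := 2 * (1 + t ^ 2))
      (fun x => (abs_waveProfile_le θ t _).trans (radialConformalFactor_le_two t _)) φ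
    exact ((continuous_waveProfile θ).comp
      (by fun_prop : Continuous fun x : Space => (t, ‖x‖))).measurable
  duality t φ := integral_waveProfile_mul θ t φ

lemma measurable_retardedWave_slice (θ t : ℝ) : Measurable fun x : Space => retardedWave θ (t, x) := by
  have h : Measurable fun x : Space => ((t, ‖x‖) : ℝ × ℝ) := by fun_prop
  have h2 : Measurable ((fun z : ℝ × ℝ => retardedProfile θ z.1 z.2) ∘
      fun x : Space => ((t, ‖x‖) : ℝ × ℝ)) := (measurable_retardedProfile θ).comp h
  simpa only [retardedWave, Function.comp_def] using h2

lemma integrable_retardedWave_slice_mul (θ t : ℝ) (φ : 𝓢(Space, ℂ)) :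
    Integrable fun x : Space => (retardedWave θ (t, x) : ℂ) * φ x := by
  refine integrable_mul_schwartz_of_abs_le (measurable_retardedWave_slice θ t)
    (C := Real.pi ^ 2 / 2 * (2 * (1 + t ^ 2))) (fun x => ?_) φ
  exact (abs_retardedProfile_le θ t (norm_nonneg _)).trans
    (mul_le_mul_of_nonneg_left (radialConformalFactor_le_two t _) (by positivity))

lemma isRetardedSolution_retardedWave (θ : ℝ) :
    IsRetardedSolution (fun p => wave θ p ^ 3) (retardedWave θ) where
  memLp_source := memLp_cube (memLp_wave θ)
  aestronglyMeasurable := (memLp_retardedWave θ).1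
  integrable_slice t φ := integrable_retardedWave_slice_mul θ t φ
  duality t φ := (integral_integral_waveProfile_cube_mul_sinPropagator θ t φ).symm

lemma ae_eq_slice {u v : Spacetime → ℝ} {t : ℝ}
    (hu : ∀ φ : 𝓢(Space, ℂ), Integrable fun x : Space => (u (t, x) : ℂ) * φ x)
    (hv : ∀ φ : 𝓢(Space, ℂ), Integrable fun x : Space => (v (t, x) : ℂ) * φ x)
    (h : ∀ φ : 𝓢(Space, ℂ), ∫ x : Space, (u (t, x) : ℂ) * φ x = ∫ x : Space, (v (t, x) : ℂ) * φ x) :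
    ∀ᵐ x : Space, u (t, x) = v (t, x) := by
  filter_upwards [ae_eq_of_forall_integral_mul_schwartz_eq
    (locallyIntegrable_of_integrable_mul_schwartz hu)
    (locallyIntegrable_of_integrable_mul_schwartz hv) h] with x hx
  exact Complex.ofReal_injective hx

/-- Fubini for null sets needs a measurable set, hence the passage to strongly measurable
representatives. -/
lemma ae_eq_of_forall_ae_eq_slice {u v : Spacetime → ℝ} (hu : AEStronglyMeasurable u volume)
    (hv : AEStronglyMeasurable v volume) (h : ∀ t, ∀ᵐ x : Space, u (t, x) = v (t, x)) :
    u =ᵐ[volume] v := by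
  obtain ⟨u', hum, hu'⟩ := hu
  obtain ⟨v', hvm, hv'⟩ := hv
  have h1 : u' =ᵐ[volume] v' := by
    have hm : MeasurableSet {p | u' p = v' p} := measurableSet_eq_fun hum.measurable hvm.measurable
    rw [Filter.EventuallyEq, Measure.volume_eq_prod]
    refine (Measure.ae_prod_iff_ae_ae hm).2 ?_
    rw [Measure.volume_eq_prod] at hu' hv'
    filter_upwards [Measure.ae_ae_of_ae_prod hu', Measure.ae_ae_of_ae_prod hv'] with t h1 h2
    filter_upwards [h1, h2, h t] with x e1 e2 e3
    rw [← e1, ← e2, e3]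
  exact hu'.trans (h1.trans hv'.symm)

lemma IsLinearWave.ae_eq {f₀ f₁ : Space → ℝ} {u v : Spacetime → ℝ} (hu : IsLinearWave f₀ f₁ u)
    (hv : IsLinearWave f₀ f₁ v) (t : ℝ) : ∀ᵐ x : Space, u (t, x) = v (t, x) :=
  ae_eq_slice (hu.integrable_slice t) (hv.integrable_slice t) fun φ =>
    (hu.duality t φ).trans (hv.duality t φ).symm

lemma IsRetardedSolution.ae_eq {F u v : Spacetime → ℝ} (hu : IsRetardedSolution F u)
    (hv : IsRetardedSolution F v) (t : ℝ) : ∀ᵐ x : Space, u (t, x) = v (t, x) :=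
  ae_eq_slice (hu.integrable_slice t) (hv.integrable_slice t) fun φ =>
    (hu.duality t φ).trans (hv.duality t φ).symm

lemma IsRetardedSolution.congr {F G w : Spacetime → ℝ} (hw : IsRetardedSolution F w)
    (hFG : F =ᵐ[volume] G) (h : ∀ t, ∀ᵐ x : Space, F (t, x) = G (t, x)) : IsRetardedSolution G w where
  memLp_source := hw.memLp_source.ae_eq hFG
  aestronglyMeasurable := hw.aestronglyMeasurable
  integrable_slice := hw.integrable_slice
  duality t φ := by
    rw [hw.duality t φ]
    refine setIntegral_congr_fun measurableSet_Iio fun s _ => integral_congr_ae ?_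
    filter_upwards [h s] with x hx
    rw [hx]

/-- The weight r² splits as (r v³)(r w), which is the Jacobian times 2 `nullSource` times
`nullPotential`. The constant is 2π · 2 · π²/512 = π³/128. -/
lemma wave_cube_mul_retardedWave (θ : ℝ) :
    Integrable (fun p => wave θ p ^ 3 * retardedWave θ p) volume ∧
      ∫ p, wave θ p ^ 3 * retardedWave θ p = Real.pi ^ 3 / 128 * (24 * Real.cos θ ^ 2 + 5) := by
  set f : ℝ × ℝ → ℝ := fun z => waveProfile θ z.1 z.2 ^ 3 * retardedProfile θ z.1 z.2 with hfdef
  have hf : Measurable f :=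
    ((continuous_waveProfile θ).measurable.pow_const 3).mul (measurable_retardedProfile θ)
  have hKm : Measurable fun z : ℝ × ℝ => 2 * (nullSource θ z.1 z.2 * nullPotential θ z.1 z.2) :=
    ((measurable_nullSource θ).mul (continuous_nullPotential θ).measurable).const_mul 2
  have heq : ∀ z : ℝ × ℝ, nullDensity z * (2 * (nullSource θ (nullMap z).1 (nullMap z).2 *
      nullPotential θ (nullMap z).1 (nullMap z).2)) = z.2 ^ 2 * f z := by
    intro z
    have h := mul_waveProfile_cube θ z.1 z.2
    have h2 : z.2 * retardedProfile θ z.1 z.2 = nullPotential θ (nullMap z).1 (nullMap z).2 := by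
      -- On the axis both null coordinates coincide, and the potential vanishes there.
      by_cases hz : z.2 = 0
      · simp [hz, nullMap, nullPotential_self]
      · rw [retardedProfile, mul_div_cancel₀ _ hz]
        rfl
    rw [hfdef]
    simp only
    rw [← h2]
    linear_combination (-(z.2 * retardedProfile θ z.1 z.2)) * h
  have hKi : IntegrableOn (fun z : ℝ × ℝ => 2 * (nullSource θ z.1 z.2 * nullPotential θ z.1 z.2))
      nullSquare := by
    refine (Continuous.continuousOn ?_ |>.integrableOn_compact
      (K := Set.Icc (-(Real.pi / 2)) (Real.pi / 2) ×ˢ Set.Icc (-(Real.pi / 2)) (Real.pi / 2))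
      (isCompact_Icc.prod isCompact_Icc)).mono_set
      (Set.prod_mono Set.Ioo_subset_Icc_self Set.Ioo_subset_Icc_self)
    refine continuous_const.mul (Continuous.mul ?_ (continuous_nullPotential θ))
    unfold nullSource
    fun_prop
  have hi : Integrable fun z : ℝ × ℝ => z.2 ^ 2 * f z :=
    ((integrable_nullMap_iff hKm).2 hKi).congr (Filter.Eventually.of_forall heq)
  refine ⟨integrable_spacetime_radial hf hi, ?_⟩
  have h1 := integral_spacetime_radial hf (fun t r => by
    simp only [hfdef, waveProfile_neg, retardedProfile_neg]) hi
  have h2 := integral_nullMap hKm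
  simp only [heq] at h2
  rw [h2, integral_const_mul, setIntegral_nullSource_mul_nullPotential] at h1
  refine h1.trans ?_
  ring

end CubicWave

theorem proposition5p3 (θ : ℝ) :
    (∃ v : CubicWave.Spacetime → ℝ,
      CubicWave.IsLinearWave (CubicWave.data₀ θ) (CubicWave.data₁ θ) v) ∧
    ∀ v : CubicWave.Spacetime → ℝ,
      CubicWave.IsLinearWave (CubicWave.data₀ θ) (CubicWave.data₁ θ) v →
        CubicWave.IsPenroseTransform v (fun q => Real.cos (q.1 - θ)) ∧
        MemLp v 4 volume ∧
        (∃ w : CubicWave.Spacetime → ℝ, CubicWave.IsRetardedSolution (fun p => v p ^ 3) w) ∧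
        ∀ w : CubicWave.Spacetime → ℝ,
          CubicWave.IsRetardedSolution (fun p => v p ^ 3) w →
            MemLp w 4 volume ∧
            Integrable (fun p => v p ^ 3 * w p) volume ∧
            ∫ p : CubicWave.Spacetime, v p ^ 3 * w p =
              Real.pi ^ 3 / 128 * (24 * Real.cos θ ^ 2 + 5) := by
  have hv₀ := CubicWave.isLinearWave_wave θ
  refine ⟨⟨_, hv₀⟩, fun v hv => ?_⟩
  -- Equality on every slice gives the Penrose transform and the retarded problem for v; equality
  -- almost everywhere on spacetime gives the integrals.
  have hs : ∀ t, ∀ᵐ x : CubicWave.Space, CubicWave.wave θ (t, x) = v (t, x) := hv₀.ae_eq hv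
  have hae := CubicWave.ae_eq_of_forall_ae_eq_slice hv₀.aestronglyMeasurable
    hv.aestronglyMeasurable hs
  have hw₀ : CubicWave.IsRetardedSolution (fun p => v p ^ 3) (CubicWave.retardedWave θ) := by
    refine (CubicWave.isRetardedSolution_retardedWave θ).congr ?_ fun t => ?_
    · filter_upwards [hae] with p hp
      rw [hp]
    · filter_upwards [hs t] with x hx
      rw [hx]
  refine ⟨fun t => ?_, (CubicWave.memLp_wave θ).ae_eq hae, ⟨_, hw₀⟩, fun w hw => ?_⟩
  · filter_upwards [hs t] with x hx
    rw [← hx]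
    rfl
  · have haw := CubicWave.ae_eq_of_forall_ae_eq_slice hw₀.aestronglyMeasurable
      hw.aestronglyMeasurable (hw₀.ae_eq hw)
    have hprod : (fun p => CubicWave.wave θ p ^ 3 * CubicWave.retardedWave θ p) =ᵐ[volume]
        fun p => v p ^ 3 * w p := by
      filter_upwards [hae, haw] with p h1 h2
      rw [h1, h2]
    obtain ⟨h1, h2⟩ := CubicWave.wave_cube_mul_retardedWave θ
    exact ⟨(CubicWave.memLp_retardedWave θ).ae_eq haw, h1.congr hprod,
      (integral_congr_ae hprod).symm.trans h2⟩
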